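/- Let $K$ be a field of characteristic $0$, let $V_3$ be the $4$-dimensional $SL_2$-module of binary cubic forms over $K$, and let $\mathcal I = K[V_3\oplus V_3]^{SL_2}$ be the algebra of polynomial $SL_2$-invariant functions on $V_3\oplus V_3$, graded by the degree of polynomials. Then $\mathcal I$ has a finite minimal (that is, irredundant) system of homogeneous generators. Let $f_1,\dots,f_m$ be any such system, let $R = K[x_1,\dots,x_m]$ be graded by $\deg x_i = \deg f_i$, and regard $\mathcal I$ as a graded $R$-module through $\varphi : R\to\mathcal I$, $x_i\mapsto f_i$. Then: 1. $\mathcal I$ is a complete intersection with two relations, of degrees $8$ and $12$: the map $\varphi$ is surjective, and $\ker\varphi = (r_1,r_2)$ for a regular sequence $r_1,r_2$ of homogeneous elements of $R$ of degrees $8$ and $12$. 2. The minimal graded free resolution of $\mathcal I$ over $R$ has the form $$0\longrightarrow R(-20)\longrightarrow R(-8)\oplus R(-12)\longrightarrow R\longrightarrow \mathcal I\longrightarrow 0,$$ that is, there is such an exact sequence of $R$-linear maps of degree $0$ in which all entries of the matrices of the maps between free modules lie in $(x_1,\dots,x_m)$. 3. The homological (projective) dimension of the $R$-module $\mathcal I$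 is $2$. -/

import Mathlib

open scoped MatrixGroups

namespace BinaryInvariants

noncomputable section

open MvPolynomial

/-! ### Binary forms and the action of `SL₂` -/

/-- The binary form `∑ i, a i * x ^ (d - i) * y ^ i` of degree `d` with coefficient vector `a`;
`x = X 0`, `y = X 1`. The `(d + 1)`-dimensional space `V_d` of binary forms of degree `d` is
`Fin (d + 1) → K` through this parametrization. -/
def binaryForm {K : Type*} [Field K] {d : ℕ} (a : Fin (d + 1) → K) : MvPolynomial (Fin 2) K :=
  ∑ i : Fin (d + 1), C (a i) * X 0 ^ (d - (i : ℕ)) * X 1 ^ (i : ℕ)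

/-- The action of `g ∈ SL₂(K)` on polynomials in `x, y`, viewed as functions on `K²`:
`(g • F)(v) = F (g⁻¹ v)`. -/
def linSubst {K : Type*} [Field K] (g : SL(2, K)) :
    MvPolynomial (Fin 2) K →ₐ[K] MvPolynomial (Fin 2) K :=
  aeval fun i : Fin 2 => ∑ j : Fin 2, C ((g⁻¹ : SL(2, K)) i j) * X j

/-- The action of `SL₂(K)` on `V_d` in coefficients: the `i`-th coefficient of `act g a` is the
coefficient of `x ^ (d - i) * y ^ i` in `g • binaryForm a`. -/
def act {K : Type*} [Field K] {d : ℕ} (g : SL(2, K)) (a : Fin (d + 1) → K) : Fin (d + 1) → K :=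
  fun i => coeff (Finsupp.single 0 (d - (i : ℕ)) + Finsupp.single 1 (i : ℕ))
    (linSubst g (binaryForm a))

theorem binaryForm_isHomogeneous {K : Type*} [Field K] {d : ℕ} (a : Fin (d + 1) → K) :
    (binaryForm a).IsHomogeneous d := by
  refine IsHomogeneous.sum _ _ _ fun i _ => ?_
  have h := ((isHomogeneous_C (Fin 2) (a i)).mul
    ((isHomogeneous_X K (0 : Fin 2)).pow (d - (i : ℕ)))).mul
    ((isHomogeneous_X K (1 : Fin 2)).pow (i : ℕ))
  have e : 0 + 1 * (d - (i : ℕ)) + 1 * (i : ℕ) = d := by omega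
  rwa [e] at h

theorem eq_binaryForm_of_isHomogeneous {K : Type*} [Field K] {d : ℕ}
    {F : MvPolynomial (Fin 2) K} (hF : F.IsHomogeneous d) :
    F = binaryForm fun i : Fin (d + 1) =>
      coeff (Finsupp.single 0 (d - (i : ℕ)) + Finsupp.single 1 (i : ℕ)) F := by
  classical
  have key : ∀ (c : K) (p q : ℕ), C c * X 0 ^ p * X 1 ^ q
      = monomial (Finsupp.single (0 : Fin 2) p + Finsupp.single 1 q) c := by
    intro c p q
    rw [X_pow_eq_monomial, X_pow_eq_monomial, C_mul_monomial, monomial_mul]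
    simp
  ext m
  unfold binaryForm
  simp only [key, coeff_sum, coeff_monomial]
  by_cases hm : m 0 + m 1 = d
  · have hm1 : m 1 < d + 1 := by omega
    have hmeq : Finsupp.single (0 : Fin 2) (d - m 1) + Finsupp.single 1 (m 1) = m := by
      ext i
      fin_cases i <;> simp
      omega
    rw [Finset.sum_eq_single (⟨m 1, hm1⟩ : Fin (d + 1))]
    · simp only [hmeq, if_true]
    · intro b _ hb
      rw [if_neg]
      intro h
      apply hb
      ext
      have := DFunLike.congr_fun h 1
      simpa using this
    · simp
  · have h0 : coeff m F = 0 := by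
      by_contra h
      apply hm
      have := hF h
      simpa [Finsupp.weight_apply, Finsupp.sum_fintype, Fin.sum_univ_two] using this
    rw [h0, Finset.sum_eq_zero]
    intro i _
    rw [if_neg]
    intro h
    apply hm
    have e0 := DFunLike.congr_fun h 0
    have e1 := DFunLike.congr_fun h 1
    simp at e0 e1
    omega

/-- The coefficient action is the action on forms. -/
theorem binaryForm_act {K : Type*} [Field K] {d : ℕ} (g : SL(2, K)) (a : Fin (d + 1) → K) :
    binaryForm (act g a) = linSubst g (binaryForm a) := by
  symm
  apply eq_binaryForm_of_isHomogeneous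
  have h := (binaryForm_isHomogeneous a).aeval
    (fun i : Fin 2 => ∑ j : Fin 2, (C ((g⁻¹ : SL(2, K)) i j) * X j : MvPolynomial (Fin 2) K))
    (n := 1) (fun i => IsHomogeneous.sum _ _ _ fun j _ => by
      simpa using (isHomogeneous_C (Fin 2) ((g⁻¹ : SL(2, K)) i j)).mul (isHomogeneous_X K j))
  rw [one_mul] at h
  exact h

/-! ### The algebra of invariants -/

/-- The algebra `K[V_d ⊕ ⋯ ⊕ V_d]^{SL₂}` (`n` summands) of polynomial invariants of `n` binary
forms of degree `d`. A polynomial function on `V_d ⊕ ⋯ ⊕ V_d` is a polynomial in the variables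
`X (j, i)`, where `X (j, i)` is the `i`-th coefficient of the `j`-th form. -/
def invariants (K : Type*) [Field K] (n d : ℕ) :
    Subalgebra K (MvPolynomial (Fin n × Fin (d + 1)) K) where
  carrier := {P | ∀ (g : SL(2, K)) (a : Fin n → Fin (d + 1) → K),
    eval (fun s => act g (a s.1) s.2) P = eval (fun s => a s.1 s.2) P}
  mul_mem' hP hQ g a := by simp only [map_mul, hP g a, hQ g a]
  add_mem' hP hQ g a := by simp only [map_add, hP g a, hQ g a]
  algebraMap_mem' r g a := by simp [algebraMap_eq]

/-- The invariants that are homogeneous of degree `e`. -/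
def invariantsOfDegree (K : Type*) [Field K] (n d : ℕ) (e : ℕ) :
    Submodule K (invariants K n d) :=
  (homogeneousSubmodule (Fin n × Fin (d + 1)) K e).comap (invariants K n d).val.toLinearMap

/-- `f 0, …, f (m - 1)` is a minimal system of homogeneous generators of the `K`-algebra `A`,
graded by `𝒜`, and `f i` is homogeneous of degree `w i`. -/
structure IsMinimalGenerators {K A : Type*} [Field K] [CommRing A] [Algebra K A]
    (𝒜 : ℕ → Submodule K A) {m : ℕ} (f : Fin m → A) (w : Fin m → ℕ) : Prop where
  homogeneous : ∀ i, f i ∈ 𝒜 (w i)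
  generates : Algebra.adjoin K (Set.range f) = ⊤
  irredundant : ∀ i, f i ∉ Algebra.adjoin K (f '' {j | j ≠ i})

/-! ### Graded free resolutions -/

/-- For `R = K[x_1, …, x_m]` with `deg x_i = w i` and `c = [c_1, …, c_r]`, the elements of degree
`e` of the graded free `R`-module `R(-c_1) ⊕ ⋯ ⊕ R(-c_r)`, where `R(-c)_e = R_{e - c}`: every
monomial `μ` of the `s`-th entry satisfies `deg μ + c_s = e`. -/
def twistedDegree {K : Type*} [Field K] {m : ℕ} (w : Fin m → ℕ) (c : List ℕ) (e : ℕ) :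
    Submodule K (Fin c.length → MvPolynomial (Fin m) K) where
  carrier := {v | ∀ s μ, coeff μ (v s) ≠ 0 → Finsupp.weight w μ + c.get s = e}
  add_mem' {u v} hu hv s μ h := by
    by_cases h' : coeff μ (u s) = 0
    · refine hv s μ fun h'' => h ?_
      simp [h', h'']
    · exact hu s μ h'
  zero_mem' s μ h := absurd (by simp) h
  smul_mem' r v hv s μ h := hv s μ fun h' => h (by simp [h'])

/-- Let `R = K[x_1, …, x_m]` with `deg x_i = w i`, and let `A` be a `K`-algebra graded by `𝒜`,
regarded as an `R`-module through `φ : R → A`. For a list `c = [c₀, …, c_l]` of lists of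
natural numbers put `F_i = ⨁ j ∈ c_i, R(-j)` for `i ≤ l` and `F_i = 0` for `i > l`. The predicate
says that `A` has a minimal graded free resolution
`0 ⟶ F_l ⟶ ⋯ ⟶ F_1 ⟶ F_0 ⟶ A ⟶ 0`: an exact sequence of `R`-linear maps of degree zero
such that the entries of the matrices of all `F_{i+1} ⟶ F_i` have zero constant term. -/
def HasMinimalFreeResolution {K A : Type*} [Field K] [CommRing A] [Algebra K A]
    (𝒜 : ℕ → Submodule K A) {m : ℕ} (w : Fin m → ℕ) (φ : MvPolynomial (Fin m) K →ₐ[K] A)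
    (c : List (List ℕ)) : Prop :=
  ∃ (ε : (Fin (c.getD 0 []).length → MvPolynomial (Fin m) K)
        →ₛₗ[(φ : MvPolynomial (Fin m) K →+* A)] A)
    (δ : ∀ i : ℕ, (Fin (c.getD (i + 1) []).length → MvPolynomial (Fin m) K)
        →ₗ[MvPolynomial (Fin m) K] (Fin (c.getD i []).length → MvPolynomial (Fin m) K)),
    Function.Surjective ε ∧
    Function.Exact (δ 0) ε ∧
    (∀ i, Function.Exact (δ (i + 1)) (δ i)) ∧
    (∀ e, ∀ v ∈ twistedDegree w (c.getD 0 []) e, ε v ∈ 𝒜 e) ∧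
    (∀ i e, ∀ v ∈ twistedDegree w (c.getD (i + 1) []) e,
      δ i v ∈ twistedDegree w (c.getD i []) e) ∧
    (∀ i v s, constantCoeff (δ i v s) = 0)

/-- The homological (projective) dimension of `A` as an `R`-module through `φ : R → A`. -/
def homologicalDimension {R A : Type*} [CommRing R] [CommRing A] (φ : R →+* A) : WithBot ℕ∞ :=
  CategoryTheory.projectiveDimension
    (@ModuleCat.of R _ A _ (Module.compHom A φ))

end

end BinaryInvariants

/-! Write a, b for the two cubics. Seven invariants are explicit: the coefficients c 0, ..., c 4 of
disc(a + t b) in t, the invariant pairing c 5, and c 6 of bidegree (3, 3). They satisfy `relation₈`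
and `relation₁₂` identically.

These two generate all relations (`ker_aeval_basic`). Restrict a relation p to a = x²y, where c 0 =
0. There c 1, c 2, c 5, c 6 take all values with c 1 ≠ 0, and the two relations determine c 3 and c
4 once c 1 is inverted. As X 1 is a nonzerodivisor modulo X 0 and the two relations, p lies in the
ideal of these three. The invariants form a domain, so the cofactor of X 0 is again a relation, and
graded Nakayama removes X 0.

The seven generate (`aeval_basic_surjective`). A linear covariant u of the pair and its image under
the endomorphism given by the Hessian of a form a frame whose area is a multiple of `frameArea`, a
polynomial in the c i. In this frame the coefficients of a and b are polynomials in the c i, so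
every invariant becomes one after multiplication by a power of `frameArea`. Exchanging a and b gives
a second denominator. The two relations and the two denominators form a regular sequence, so the
denominators cancel. Regularity is reduced to powers of variables, homogeneous regular sequences
being permutable.

The relations have no linear terms, so the seven generators are minimal, and any other minimal
system differs from them by a graded isomorphism of polynomial rings. The Koszul complex of the
transported relations is the resolution; its length is the projective dimension because a shorter
one would split it and force the unit ideal. -/

namespace BinaryInvariants

/-! ### Graded Nakayama lemma. -/

section Graded

variable {K A : Type*} [CommRing K] [CommRing A] [Algebra K A] (𝒜 : ℕ → Submodule K A)
  [GradedAlgebra 𝒜]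

open DirectSum

/-- The comap is the colon ideal `J : b`, to which `RegSeq.swap` applies `graded_nakayama`. -/
theorem isHomogeneous_comap_mulLeft {J : Ideal A} (hJ : J.IsHomogeneous 𝒜) {b : A} {e : ℕ}
    (hb : b ∈ 𝒜 e) : Ideal.IsHomogeneous 𝒜 (Submodule.comap (LinearMap.mulLeft A b) J) := by
  intro i p hp
  have h := hJ (e + i) hp
  rw [LinearMap.mulLeft_apply, coe_decompose_mul_add_of_left_mem 𝒜 hb] at h
  exact h

/-- A graded version of Nakayama's lemma for one homogeneous element of positive degree. -/
theorem graded_nakayama {N J : Ideal A} (hN : N.IsHomogeneous 𝒜) (hJ : J.IsHomogeneous 𝒜)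
    {a : A} {k : ℕ} (hk : 0 < k) (ha : a ∈ 𝒜 k) (h : ∀ n ∈ N, ∃ n' ∈ N, n - a * n' ∈ J) :
    N ≤ J := by
  have key : ∀ d, ∀ n ∈ N, n ∈ 𝒜 d → n ∈ J := by
    intro d
    induction d using Nat.strong_induction_on with
    | _ d ih =>
      intro n hn hnd
      -- The degree `d` component of `n - a * n'` is `n` minus `a` times the component of `n'` of
      -- degree `d - k`. The latter is in `J` by induction, and is absent if `d < k`.
      obtain ⟨n', hn', hs⟩ := h n hn
      have hc := hJ d hs
      rw [decompose_sub, DirectSum.sub_apply, Submodule.coe_sub, decompose_of_mem_same 𝒜 hnd] at hc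
      by_cases hkd : k ≤ d
      · rw [coe_decompose_mul_of_left_mem_of_le 𝒜 ha hkd] at hc
        have h2 := ih (d - k) (by omega) _ (hN (d - k) hn') (SetLike.coe_mem _)
        simpa using J.add_mem hc (J.mul_mem_left a h2)
      · rw [coe_decompose_mul_of_left_mem_of_not_le 𝒜 ha hkd] at hc
        simpa using hc
  intro n hn
  rw [hJ.mem_iff]
  exact fun i => key i _ (hN i hn) (SetLike.coe_mem _)

end Graded

/-! ### Regular sequences and their permutation. -/

section RegSeq

variable {A : Type*} [CommRing A]

/-- `a` is a nonzerodivisor modulo `J`. -/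
def RegMod (J : Ideal A) (a : A) : Prop := ∀ p, a * p ∈ J → p ∈ J

/-- The list is a weakly regular sequence on `A ⧸ J`. -/
def RegSeq : Ideal A → List A → Prop
  | _, [] => True
  | J, a :: l => RegMod J a ∧ RegSeq (J ⊔ Ideal.span {a}) l

theorem mem_sup_span_singleton' {J : Ideal A} {a x : A} :
    x ∈ J ⊔ Ideal.span {a} ↔ ∃ p, x - a * p ∈ J := by
  rw [Submodule.mem_sup]
  constructor
  · rintro ⟨y, hy, z, hz, rfl⟩
    obtain ⟨p, rfl⟩ := Ideal.mem_span_singleton'.1 hz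
    exact ⟨p, by rwa [mul_comm a p, add_sub_cancel_right]⟩
  · rintro ⟨p, hp⟩
    exact ⟨_, hp, a * p, Ideal.mem_span_singleton'.2 ⟨p, mul_comm _ _⟩, by ring⟩

/-- Since `u` is a unit, `a` and `b` are associates modulo `J`. -/
theorem RegMod.congr {J : Ideal A} {a b u v : A} (ha : RegMod J a) (huv : v * u = 1)
    (h : b - u * a ∈ J) : RegMod J b := by
  intro p hp
  have h1 : a * p ∈ J := by
    have h2 := J.mul_mem_left v (J.sub_mem hp (J.mul_mem_right p h))
    have e : v * (b * p - (b - u * a) * p) = (v * u) * (a * p) := by ring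
    rwa [e, huv, one_mul] at h2
  exact ha p h1

theorem sup_span_singleton_congr {J : Ideal A} {a b u v : A} (huv : v * u = 1)
    (h : b - u * a ∈ J) : J ⊔ Ideal.span {a} = J ⊔ Ideal.span {b} := by
  apply le_antisymm
  · refine sup_le le_sup_left ?_
    rw [Ideal.span_singleton_le_iff_mem, mem_sup_span_singleton']
    refine ⟨v, ?_⟩
    have h2 := J.mul_mem_left (-v) h
    have e : -v * (b - u * a) = (v * u) * a - b * v := by ring
    rwa [e, huv, one_mul] at h2
  · refine sup_le le_sup_left ?_
    rw [Ideal.span_singleton_le_iff_mem, mem_sup_span_singleton']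
    exact ⟨u, by rwa [mul_comm a u]⟩

theorem RegSeq.head_congr {J : Ideal A} {a b u v : A} {l : List A} (huv : v * u = 1)
    (h : b - u * a ∈ J) (H : RegSeq J (a :: l)) : RegSeq J (b :: l) :=
  ⟨H.1.congr huv h, by rw [← sup_span_singleton_congr huv h]; exact H.2⟩

variable {K : Type*} [CommRing K] [Algebra K A] (𝒜 : ℕ → Submodule K A) [GradedAlgebra 𝒜]

theorem isHomogeneous_sup_span {J : Ideal A} (hJ : J.IsHomogeneous 𝒜) {b : A} {e : ℕ}
    (hb : b ∈ 𝒜 e) : (J ⊔ Ideal.span {b}).IsHomogeneous 𝒜 :=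
  hJ.sup (Ideal.homogeneous_span 𝒜 _ (by rintro x rfl; exact ⟨e, hb⟩))

theorem RegSeq.swap {J : Ideal A} (hJ : J.IsHomogeneous 𝒜) {a b : A} {d e : ℕ} (hd : 0 < d)
    (ha : a ∈ 𝒜 d) (hb : b ∈ 𝒜 e) {l : List A} (H : RegSeq J (a :: b :: l)) :
    RegSeq J (b :: a :: l) := by
  obtain ⟨h1, h2, h3⟩ := H
  -- Nakayama for the colon ideal `J : b`: if `b * n ∈ J`, then `n ≡ a * n'` modulo `J` by
  -- regularity of `b` modulo `(J, a)`, and cancelling `a` in `a * (b * n') ∈ J` puts `n'` in the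
  -- colon ideal again.
  have hbJ : RegMod J b := by
    have := graded_nakayama 𝒜 (isHomogeneous_comap_mulLeft 𝒜 hJ hb) hJ hd ha (fun n hn => by
      have hn' : b * n ∈ J := hn
      obtain ⟨n', hn''⟩ := mem_sup_span_singleton'.1 (h2 n (Ideal.mem_sup_left hn'))
      refine ⟨n', h1 _ ?_, hn''⟩
      have := J.sub_mem hn' (J.mul_mem_left b hn'')
      rw [LinearMap.mulLeft_apply]
      convert this using 1
      ring)
    exact fun p hp => this hp
  refine ⟨hbJ, fun p hp => ?_, ?_⟩
  -- From `a * p ≡ b * q` follows `q ≡ a * r`, and cancelling `a` gives `p ≡ b * r` modulo `J`.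
  · obtain ⟨q, hq⟩ := mem_sup_span_singleton'.1 hp
    have hq' : b * q ∈ J ⊔ Ideal.span {a} := mem_sup_span_singleton'.2 ⟨p, by
      have := J.neg_mem hq
      rwa [neg_sub] at this⟩
    obtain ⟨r, hr⟩ := mem_sup_span_singleton'.1 (h2 q hq')
    refine mem_sup_span_singleton'.2 ⟨r, h1 _ ?_⟩
    have := J.add_mem hq (J.mul_mem_left b hr)
    convert this using 1
    ring
  · have e1 : J ⊔ Ideal.span {b} ⊔ Ideal.span {a} = J ⊔ Ideal.span {a} ⊔ Ideal.span {b} :=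
      sup_right_comm _ _ _
    rwa [e1]

theorem RegSeq.perm {l l' : List A} (hl : l.Perm l') :
    ∀ {J : Ideal A}, J.IsHomogeneous 𝒜 → (∀ a ∈ l, ∃ d, 0 < d ∧ a ∈ 𝒜 d) →
      RegSeq J l → RegSeq J l' := by
  induction hl with
  | nil => exact fun _ _ h => h
  | cons x _ ih =>
    intro J hJ hl H
    obtain ⟨d, -, hd⟩ := hl x (by simp)
    exact ⟨H.1, ih (isHomogeneous_sup_span 𝒜 hJ hd) (fun a ha => hl a (by simp [ha])) H.2⟩
  | swap x y l =>
    intro J hJ hl H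
    obtain ⟨d, hd0, hd⟩ := hl y (by simp)
    obtain ⟨e, -, he⟩ := hl x (by simp)
    exact H.swap 𝒜 hJ hd0 hd he
  | trans h1 _ ih1 ih2 =>
    intro J hJ hl H
    exact ih2 hJ (fun a ha => hl a (h1.mem_iff.2 ha)) (ih1 hJ hl H)

end RegSeq

/-! ### Powers of distinct variables form a regular sequence. -/

section Monomials

open MvPolynomial

variable {σ K : Type*} [CommRing K]

/-- Membership in a monomial ideal is tested on each monomial, and multiplication by a power of `X
i` with `i ∉ S` leaves the exponents in `S` unchanged. -/
theorem regMod_span_X_pow {S : Set σ} (e : σ → ℕ) {i : σ} (hi : i ∉ S) :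
    RegMod (Ideal.span ((fun s => (X s : MvPolynomial σ K) ^ e s) '' S)) (X i ^ e i) := by
  classical
  have key : ∀ p : MvPolynomial σ K,
      p ∈ Ideal.span ((fun s => (X s : MvPolynomial σ K) ^ e s) '' S) ↔
        ∀ μ, coeff μ p ≠ 0 → ∃ s ∈ S, e s ≤ μ s := by
    intro p
    have e1 : (fun s => (X s : MvPolynomial σ K) ^ e s) '' S =
        (fun s => monomial s (1 : K)) '' ((fun s => Finsupp.single s (e s)) '' S) := by
      rw [Set.image_image]
      simp only [X_pow_eq_monomial]
    rw [e1, mem_ideal_span_monomial_image]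
    simp [Finsupp.single_le_iff]
  intro p hp
  rw [key] at hp ⊢
  intro μ hμ
  obtain ⟨s, hs, h⟩ := hp (Finsupp.single i (e i) + μ) (by
    rw [X_pow_eq_monomial, coeff_monomial_mul]; simpa using hμ)
  have hsi : i ≠ s := fun h => hi (h ▸ hs)
  refine ⟨s, hs, ?_⟩
  simpa [Finsupp.single_apply, hsi] using h

theorem regSeq_X_pow (e : σ → ℕ) : ∀ (l : List σ) (S : Set σ), l.Nodup → (∀ i ∈ l, i ∉ S) →
    RegSeq (Ideal.span ((fun s => (X s : MvPolynomial σ K) ^ e s) '' S))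
      (l.map fun i => X i ^ e i)
  | [], _, _, _ => trivial
  | i :: l, S, hl, hS => by
    refine ⟨regMod_span_X_pow e (hS i (by simp)), ?_⟩
    have := regSeq_X_pow e l (S ∪ {i}) (List.nodup_cons.1 hl).2 (fun j hj hj' => by
      rcases hj' with h | h
      · exact hS j (by simp [hj]) h
      · exact (List.nodup_cons.1 hl).1 (h ▸ hj))
    rwa [Set.image_union, Ideal.span_union, Set.image_singleton] at this

end Monomials

end BinaryInvariants

namespace BinaryInvariants

universe u

/-! ### Projective dimension of a quotient by a regular sequence of length two. -/

section ProjectiveDimension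

open CategoryTheory

variable {R : Type u} [CommRing R]

/-- Syzygies of a regular sequence of length two. -/
theorem koszul_syzygy {r₁ r₂ x y : R} (h₁ : ∀ p, r₁ * p = 0 → p = 0)
    (h₂ : RegMod (Ideal.span {r₁}) r₂) (h : r₁ * x + r₂ * y = 0) :
    ∃ z, x = -(r₂ * z) ∧ y = r₁ * z := by
  obtain ⟨z, hz⟩ := Ideal.mem_span_singleton'.1 (h₂ y (Ideal.mem_span_singleton'.2 ⟨-x, by
    linear_combination -h⟩))
  refine ⟨z, ?_, by rw [← hz, mul_comm]⟩
  have := h₁ (x + r₂ * z) (by rw [← hz] at h; linear_combination h)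
  linear_combination this

/-- The Koszul complex gives the upper bound. Were the dimension at most 1, the ideal would be
projective and the surjection `g` from `R × R` onto it would split. -/
theorem projectiveDimension_eq_two {M : Type u} [AddCommGroup M] [Module R M] (f : R →ₗ[R] M)
    (hf : Function.Surjective f) {r₁ r₂ : R} (hker : LinearMap.ker f = Ideal.span {r₁, r₂})
    (h₁ : ∀ p, r₁ * p = 0 → p = 0) (h₂ : RegMod (Ideal.span {r₁}) r₂)
    (hne : Ideal.span {r₁, r₂} ≠ ⊤) : projectiveDimension (ModuleCat.of R M) = 2 := by
  have hmem : ∀ v : R × R, r₁ * v.1 + r₂ * v.2 ∈ LinearMap.ker f := fun v => by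
    rw [hker, Ideal.mem_span_pair]
    exact ⟨v.1, v.2, by ring⟩
  let g : (R × R) →ₗ[R] LinearMap.ker f :=
    { toFun := fun v => ⟨r₁ * v.1 + r₂ * v.2, hmem v⟩
      map_add' := fun v w => by ext; simp; ring
      map_smul' := fun c v => by ext; simp; ring }
  have hgv : ∀ v, (g v : R) = r₁ * v.1 + r₂ * v.2 := fun _ => rfl
  have hg : Function.Surjective g := by
    rintro ⟨x, hx⟩
    have hx' := hx
    rw [hker, Ideal.mem_span_pair] at hx'
    obtain ⟨a, b, hab⟩ := hx'
    refine ⟨(a, b), Subtype.ext ?_⟩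
    change r₁ * a + r₂ * b = x
    rw [← hab]
    ring
  have hmk : ∀ z : R, ((-(r₂ * z), r₁ * z) : R × R) ∈ LinearMap.ker g := fun z => by
    rw [LinearMap.mem_ker]; ext; rw [hgv]; simp; ring
  have hkg : ∀ v ∈ LinearMap.ker g, ∃ z, v = (-(r₂ * z), r₁ * z) := fun v hv => by
    have h0 := congrArg Subtype.val (LinearMap.mem_ker.1 hv)
    rw [hgv] at h0
    obtain ⟨z, hz1, hz2⟩ := koszul_syzygy h₁ h₂ h0
    exact ⟨z, Prod.ext hz1 hz2⟩
  let k : R →ₗ[R] LinearMap.ker g :=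
    { toFun := fun z => ⟨(-(r₂ * z), r₁ * z), hmk z⟩
      map_add' := fun v w => by ext <;> simp <;> ring
      map_smul' := fun c v => by ext <;> simp <;> ring }
  have hk : Function.Bijective k := by
    constructor
    · intro a b hab
      have : r₁ * a = r₁ * b := congrArg (fun v : LinearMap.ker g => (v : R × R).2) hab
      have := h₁ (a - b) (by rw [mul_sub, this, sub_self])
      exact sub_eq_zero.1 this
    · rintro ⟨v, hv⟩
      obtain ⟨z, rfl⟩ := hkg v hv
      exact ⟨z, rfl⟩
  have hpR : Projective (ModuleCat.of R R) :=
    (IsProjective.iff_projective (R := R) (P := R)).1 inferInstance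
  have hpRR : Projective (ModuleCat.of R (R × R)) :=
    (IsProjective.iff_projective (R := R) (P := R × R)).1 inferInstance
  have S1 := LinearMap.shortExact_shortComplexKer hf
  have S2 := LinearMap.shortExact_shortComplexKer hg
  apply le_antisymm
  · have hKg : Projective (ModuleCat.of R (LinearMap.ker g)) := by
      have : Module.Projective R (LinearMap.ker g) :=
        Module.Projective.of_equiv (LinearEquiv.ofBijective k hk)
      exact (IsProjective.iff_projective (R := R) (P := LinearMap.ker g)).1 this
    rw [projective_iff_hasProjectiveDimensionLT_one] at hKg
    have h2 := (S2.hasProjectiveDimensionLT_X₃_iff 0 hpRR).2 hKg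
    have h3 := (S1.hasProjectiveDimensionLT_X₃_iff 1 hpR).2 h2
    exact (projectiveDimension_le_iff _ 2).2 h3
  · refine (projectiveDimension_ge_iff _ 2).2 fun h => hne ?_
    have h2 := (S1.hasProjectiveDimensionLT_X₃_iff 0 hpR).1 h
    have h3 : Projective (ModuleCat.of R (LinearMap.ker f)) :=
      (projective_iff_hasProjectiveDimensionLT_one).2 h2
    have h4 : Module.Projective R (LinearMap.ker f) := (IsProjective.iff_projective _).2 h3
    obtain ⟨s, hs⟩ := Module.projective_lifting_property g LinearMap.id hg
    have hs' : ∀ v, g (v - s (g v)) = 0 := fun v => by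
      rw [map_sub, sub_eq_zero]; exact (LinearMap.congr_fun hs (g v)).symm
    -- The map `v ↦ v - s (g v)` retracts `R × R` onto the syzygies and so fixes `(-r₂, r₁)`.
    -- Expanding over the standard basis, the second coordinate reads `r₁ = r₁ * (r₁ * z₂ - r₂ *
    -- z₁)`; cancelling `r₁` puts 1 in the ideal.
    obtain ⟨z₁, hz₁⟩ := hkg _ (LinearMap.mem_ker.2 (hs' (1, 0)))
    obtain ⟨z₂, hz₂⟩ := hkg _ (LinearMap.mem_ker.2 (hs' (0, 1)))
    have e : ((-r₂, r₁) : R × R) = -r₂ • (1, 0) + r₁ • (0, 1) := by ext <;> simp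
    have hg0 : g (-r₂, r₁) = 0 := by
      have := LinearMap.mem_ker.1 (hmk 1)
      simpa using this
    have h5 : ((-r₂, r₁) : R × R) = -r₂ • (-(r₂ * z₁), r₁ * z₁) + r₁ • (-(r₂ * z₂), r₁ * z₂) := by
      rw [← hz₁, ← hz₂, smul_sub, smul_sub]
      have : -r₂ • s (g (1, 0)) + r₁ • s (g (0, 1)) = 0 := by
        rw [← map_smul, ← map_smul, ← map_smul, ← map_smul, ← map_add, ← map_add, ← e, hg0,
          map_zero]
      rw [sub_add_sub_comm, this, sub_zero]
      exact e
    have h6 := congrArg Prod.snd h5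
    simp only [Prod.snd_add, Prod.smul_snd, smul_eq_mul] at h6
    have h7 := h₁ (1 + r₂ * z₁ - r₁ * z₂) (by linear_combination h6)
    rw [Ideal.eq_top_iff_one, Ideal.mem_span_pair]
    exact ⟨z₂, -z₁, by linear_combination -h7⟩

end ProjectiveDimension

/-! ### The Koszul complex as a minimal graded resolution. -/

section Koszul

open MvPolynomial

variable {K A : Type*} [Field K] [CommRing A] [Algebra K A] {𝒜 : ℕ → Submodule K A} {m : ℕ}
  {w : Fin m → ℕ}

theorem weight_of_coeff_mul_ne_zero {r p : MvPolynomial (Fin m) K} {d c e : ℕ}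
    (hr : r.IsWeightedHomogeneous w d)
    (hp : ∀ μ, coeff μ p ≠ 0 → Finsupp.weight w μ + (c + d) = e) (μ : Fin m →₀ ℕ)
    (h : coeff μ (r * p) ≠ 0) : Finsupp.weight w μ + c = e := by
  classical
  rw [coeff_mul] at h
  obtain ⟨x, hx, hne⟩ := Finset.exists_ne_zero_of_sum_ne_zero h
  rw [← Finset.HasAntidiagonal.mem_antidiagonal.1 hx, map_add]
  have h1 := hr (left_ne_zero_of_mul hne)
  have h2 := hp _ (right_ne_zero_of_mul hne)
  omega

theorem hasMinimalFreeResolution_of_regular (φ : MvPolynomial (Fin m) K →ₐ[K] A)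
    (hφ : Function.Surjective φ) (hgr : ∀ e p, p.IsWeightedHomogeneous w e → φ p ∈ 𝒜 e)
    {r₁ r₂ : MvPolynomial (Fin m) K} {d₁ d₂ : ℕ} (hr₁ : r₁.IsWeightedHomogeneous w d₁)
    (hr₂ : r₂.IsWeightedHomogeneous w d₂) (hc₁ : constantCoeff r₁ = 0)
    (hc₂ : constantCoeff r₂ = 0) (h₁ : ∀ p, r₁ * p = 0 → p = 0)
    (h₂ : RegMod (Ideal.span {r₁}) r₂) (hker : RingHom.ker φ = Ideal.span {r₁, r₂}) :
    HasMinimalFreeResolution 𝒜 w φ [[0], [d₁, d₂], [d₁ + d₂]] := by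
  let R := MvPolynomial (Fin m) K
  let ε : (Fin 1 → R) →ₛₗ[(φ : R →+* A)] A :=
    { toFun := fun v => φ (v 0)
      map_add' := fun v w => by simp
      map_smul' := fun c v => by simp }
  let δ₀ : (Fin 2 → R) →ₗ[R] (Fin 1 → R) :=
    { toFun := fun v _ => r₁ * v 0 + r₂ * v 1
      map_add' := fun v w => by ext1; simp; ring
      map_smul' := fun c v => by ext1; simp; ring }
  let δ₁ : (Fin 1 → R) →ₗ[R] (Fin 2 → R) :=
    { toFun := fun v => ![-(r₂ * v 0), r₁ * v 0]
      map_add' := fun v w => by ext1 i; fin_cases i <;> simp <;> ring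
      map_smul' := fun c v => by ext1 i; fin_cases i <;> simp <;> ring }
  -- From index 2 on the source has rank 0, so the maps are zero.
  refine ⟨ε, fun i => match i with
    | 0 => δ₀
    | 1 => δ₁
    | _ + 2 => 0, ?_, ?_, ?_, ?_, ?_, ?_⟩
  · intro a
    obtain ⟨p, rfl⟩ := hφ a
    exact ⟨fun _ => p, rfl⟩
  · intro (v : Fin 1 → R)
    change φ (v 0) = 0 ↔ ∃ y, δ₀ y = v
    rw [← AlgHom.coe_toRingHom, ← RingHom.mem_ker]
    have hk : v 0 ∈ RingHom.ker φ ↔ ∃ y, δ₀ y = v := by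
      rw [hker, Ideal.mem_span_pair]
      constructor
      · rintro ⟨a, b, hab⟩
        refine ⟨![a, b], ?_⟩
        ext1 i
        fin_cases i
        change r₁ * a + r₂ * b = v 0
        rw [← hab]
        ring
      · rintro ⟨y, rfl⟩
        exact ⟨y 0, y 1, by change _ = r₁ * y 0 + r₂ * y 1; ring⟩
    exact hk
  · intro i
    match i with
    | 0 =>
      intro (v : Fin 2 → R)
      change δ₀ v = 0 ↔ ∃ y, δ₁ y = v
      constructor
      · intro h
        obtain ⟨z, hz1, hz2⟩ := koszul_syzygy h₁ h₂ (congrFun h 0)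
        refine ⟨fun _ => z, ?_⟩
        ext1 i
        fin_cases i
        · exact hz1.symm
        · exact hz2.symm
      · rintro ⟨y, rfl⟩
        ext1 i
        change r₁ * (-(r₂ * y 0)) + r₂ * (r₁ * y 0) = 0
        ring
    | 1 =>
      -- Exactness here is injectivity of `δ₁`, seen on the second coordinate by cancelling `r₁`.
      intro (v : Fin 1 → R)
      change δ₁ v = 0 ↔ ∃ y, (0 : (Fin 0 → R) →ₗ[R] (Fin 1 → R)) y = v
      constructor
      · intro h
        refine ⟨0, ?_⟩
        ext1 i
        fin_cases i
        exact (h₁ _ (congrFun h 1)).symm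
      · rintro ⟨y, rfl⟩
        simp
    | i + 2 =>
      intro v
      exact ⟨fun _ => ⟨0, _root_.funext fun (j : Fin 0) => j.elim0⟩, fun _ => rfl⟩
  · intro e (v : Fin 1 → R) (hv : v ∈ twistedDegree w [0] e)
    exact hgr e (v 0) fun μ hμ => hv 0 μ hμ
  · intro i e
    match i with
    | 0 =>
      intro (v : Fin 2 → R) (hv : v ∈ twistedDegree w [d₁, d₂] e)
      change δ₀ v ∈ twistedDegree w [0] e
      intro s μ hμ
      have hs : [0].get s = 0 := by simp
      rw [hs]
      change coeff μ (r₁ * v 0 + r₂ * v 1) ≠ 0 at hμ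
      rw [coeff_add] at hμ
      by_cases h : coeff μ (r₁ * v 0) = 0
      · rw [h, zero_add] at hμ
        exact weight_of_coeff_mul_ne_zero hr₂ (fun ν hν => by rw [zero_add]; exact hv 1 ν hν) μ hμ
      · exact weight_of_coeff_mul_ne_zero hr₁ (fun ν hν => by rw [zero_add]; exact hv 0 ν hν) μ h
    | 1 =>
      intro (v : Fin 1 → R) (hv : v ∈ twistedDegree w [d₁ + d₂] e)
      change δ₁ v ∈ twistedDegree w [d₁, d₂] e
      have hv' : ∀ ν, coeff ν (v 0) ≠ 0 → Finsupp.weight w ν + (d₁ + d₂) = e :=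
        fun ν hν => hv 0 ν hν
      intro s μ hμ
      fin_cases s
      · change coeff μ (-(r₂ * v 0)) ≠ 0 at hμ
        rw [coeff_neg, neg_ne_zero] at hμ
        exact weight_of_coeff_mul_ne_zero hr₂ hv' μ hμ
      · change coeff μ (r₁ * v 0) ≠ 0 at hμ
        exact weight_of_coeff_mul_ne_zero hr₁ (c := d₂) (fun ν hν => by
          rw [add_comm d₂ d₁]; exact hv' ν hν) μ hμ
    | i + 2 =>
      intro v _ s μ hμ
      exact absurd (by simp) hμ
  · intro i
    match i with
    | 0 =>
      intro (v : Fin 2 → R) (s : Fin 1)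
      change constantCoeff (r₁ * v 0 + r₂ * v 1) = 0
      simp [hc₁, hc₂]
    | 1 =>
      intro (v : Fin 1 → R) (s : Fin 2)
      change constantCoeff ((![-(r₂ * v 0), r₁ * v 0] : Fin 2 → R) s) = 0
      fin_cases s <;> simp [hc₁, hc₂]
    | i + 2 => simp

theorem homologicalDimension_eq_two {K A : Type u} [Field K] [CommRing A] [Algebra K A] {m : ℕ}
    (φ : MvPolynomial (Fin m) K →ₐ[K] A)
    (hφ : Function.Surjective φ) {r₁ r₂ : MvPolynomial (Fin m) K}
    (h₁ : ∀ p, r₁ * p = 0 → p = 0)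
    (h₂ : RegMod (Ideal.span {r₁}) r₂) (hker : RingHom.ker φ = Ideal.span {r₁, r₂})
    (hne : Ideal.span {r₁, r₂} ≠ ⊤) : homologicalDimension φ.toRingHom = 2 := by
  let := Module.compHom A φ.toRingHom
  let f : MvPolynomial (Fin m) K →ₗ[MvPolynomial (Fin m) K] A :=
    { toFun := φ
      map_add' := map_add φ
      map_smul' := fun c v => map_mul φ c v }
  exact projectiveDimension_eq_two f hφ hker h₁ h₂ hne

end Koszul

end BinaryInvariants

namespace BinaryInvariants

/-! ### Uniqueness of minimal homogeneous generators up to graded isomorphism. -/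

section Generators

open MvPolynomial

/-- The kernels of the iterates stabilise, say at `n`. If `x = θ ^ n y` is killed by `θ`, then `y`
is in the kernel of `θ ^ (n + 1)`, hence of `θ ^ n`, and `x = 0`. -/
theorem injective_of_surjective_ringEndomorphism {R : Type*} [CommRing R] [IsNoetherianRing R]
    (θ : R →+* R) (hθ : Function.Surjective θ) : Function.Injective θ := by
  let k : ℕ →o Ideal R := ⟨fun n => RingHom.ker (θ ^ n), monotone_nat_of_le_succ fun n x hx => by
    rw [RingHom.mem_ker] at hx ⊢
    rw [pow_succ', RingHom.mul_def, RingHom.comp_apply, hx, map_zero]⟩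
  obtain ⟨n, hn⟩ := monotone_stabilizes_iff_noetherian.2 ‹IsNoetherianRing R› k
  have hsurj : ∀ n : ℕ, Function.Surjective (θ ^ n : R →+* R) := fun n => by
    rw [RingHom.coe_pow]
    exact hθ.iterate n
  rw [injective_iff_map_eq_zero]
  intro x hx
  obtain ⟨y, rfl⟩ := hsurj n x
  have h1 : y ∈ k (n + 1) := by
    change y ∈ RingHom.ker (θ ^ (n + 1))
    rw [RingHom.mem_ker, pow_succ', RingHom.mul_def, RingHom.comp_apply, hx]
  rw [← hn (n + 1) (Nat.le_succ n)] at h1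
  exact h1

variable {K A σ : Type*} [Field K] [CommRing A] [Algebra K A] {𝒜 : ℕ → Submodule K A}

/-- A finite sum of homogeneous elements that is homogeneous is equal to the summand of its
degree. -/
def IndependentGrading (𝒜 : ℕ → Submodule K A) : Prop :=
  ∀ (s : Finset ℕ) (x : ℕ → A), (∀ e, x e ∈ 𝒜 e) → ∀ d ∈ s, ∑ e ∈ s, x e ∈ 𝒜 d →
    ∑ e ∈ s, x e = x d

theorem aeval_mem_graded [SetLike.GradedMonoid 𝒜] {f : σ → A} {w : σ → ℕ}
    (hf : ∀ i, f i ∈ 𝒜 (w i)) {p : MvPolynomial σ K} {e : ℕ} (hp : p.IsWeightedHomogeneous w e) :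
    aeval f p ∈ 𝒜 e := by
  rw [aeval_def, eval₂_eq]
  refine Submodule.sum_mem _ fun μ hμ => ?_
  rw [← Algebra.smul_def]
  refine Submodule.smul_mem _ _ ?_
  have := SetLike.prod_pow_mem_graded 𝒜 w f (F := μ.support) μ fun k _ => hf k
  have e1 : ∑ k ∈ μ.support, μ k • w k = e := by
    rw [← hp (mem_support_iff.1 hμ)]
    rfl
  rwa [e1] at this

theorem sum_range_weightedHomogeneousComponent (w : σ → ℕ) (p : MvPolynomial σ K) (n : ℕ) :
    ∃ s : Finset ℕ, n ∈ s ∧ ∑ e ∈ s, weightedHomogeneousComponent w e p = p := by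
  classical
  refine ⟨insert n (p.support.image (Finsupp.weight w)), by simp, ?_⟩
  ext μ
  rw [coeff_sum]
  simp only [coeff_weightedHomogeneousComponent, Finset.sum_ite_eq]
  split_ifs with h
  · rfl
  · by_contra h'
    exact h (Finset.mem_insert_of_mem (Finset.mem_image_of_mem _ (mem_support_iff.2 (Ne.symm h'))))

theorem aeval_weightedHomogeneousComponent [SetLike.GradedMonoid 𝒜] (hA : IndependentGrading 𝒜)
    {f : σ → A} {w : σ → ℕ} (hf : ∀ i, f i ∈ 𝒜 (w i)) {p : MvPolynomial σ K} {d : ℕ}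
    (h : aeval f p ∈ 𝒜 d) : aeval f (weightedHomogeneousComponent w d p) = aeval f p := by
  obtain ⟨s, hd, hs⟩ := sum_range_weightedHomogeneousComponent w p d
  have := hA s (fun e => aeval f (weightedHomogeneousComponent w e p))
    (fun e => aeval_mem_graded hf (weightedHomogeneousComponent_isWeightedHomogeneous e p)) d hd
  rw [← map_sum, hs] at this
  exact (this h).symm

theorem mem_supported_of_forall {p : MvPolynomial σ K} {s : Set σ}
    (h : ∀ μ, coeff μ p ≠ 0 → ∀ j, μ j ≠ 0 → j ∈ s) : p ∈ supported K s := by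
  rw [mem_supported]
  intro j hj
  obtain ⟨μ, hμ, hj⟩ := (mem_vars_iff_mem_support j).1 hj
  exact h μ (mem_support_iff.1 hμ) j (Finsupp.mem_support_iff.1 hj)

theorem aeval_mem_adjoin_of_mem_supported {f : σ → A} {p : MvPolynomial σ K} {s : Set σ}
    (h : p ∈ supported K s) : aeval f p ∈ Algebra.adjoin K (f '' s) := by
  have h1 : (aeval f p : A) ∈ (supported K s).map (aeval f) := ⟨p, h, rfl⟩
  rw [supported_eq_adjoin_X, AlgHom.map_adjoin, Set.image_image] at h1
  simpa using h1

/-- With positive weights, a monomial divisible by `X j` and of weight at most `w j` has no room for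
another factor. -/
theorem eq_single_of_weight {w : σ → ℕ} (hw : ∀ i, 0 < w i) {μ : σ →₀ ℕ} {j : σ}
    (h : μ j ≠ 0) (hle : Finsupp.weight w μ ≤ w j) : μ = Finsupp.single j 1 := by
  classical
  obtain ⟨ν, rfl⟩ : ∃ ν, μ = Finsupp.single j 1 + ν :=
    ⟨μ - Finsupp.single j 1, (add_tsub_cancel_of_le (by
      rw [Finsupp.single_le_iff]; omega)).symm⟩
  rw [map_add, Finsupp.weight_single] at hle
  have h0 : Finsupp.weight w ν = 0 := by
    simp at hle
    exact hle
  have : ν = 0 := by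
    ext i
    by_contra hi
    have h1 := Finsupp.le_weight_of_ne_zero' w hi
    have := hw i
    omega
  rw [this, add_zero]

theorem IsMinimalGenerators.surjective {m : ℕ} {f : Fin m → A} {w : Fin m → ℕ}
    (h : IsMinimalGenerators 𝒜 f w) : Function.Surjective (aeval (R := K) f) := by
  rw [← AlgHom.range_eq_top, ← Algebra.adjoin_range_eq_range_aeval, h.generates]

theorem IsMinimalGenerators.weight_pos (h0 : ∀ x ∈ 𝒜 0, ∃ c : K, x = algebraMap K A c) {m : ℕ}
    {f : Fin m → A} {w : Fin m → ℕ} (h : IsMinimalGenerators 𝒜 f w) (i : Fin m) : 0 < w i := by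
  by_contra hi
  have h1 := h.homogeneous i
  rw [show w i = 0 by omega] at h1
  obtain ⟨c, hc⟩ := h0 _ h1
  exact h.irredundant i (hc ▸ Subalgebra.algebraMap_mem _ c)

/-- For weight reasons `X i` occurs in `q` only in its linear term, so the relation can be solved
for `f i`. -/
theorem mem_adjoin_of_coeff_single_ne_zero {m : ℕ} {f : Fin m → A} {w : Fin m → ℕ}
    (hw : ∀ i, 0 < w i) {q : MvPolynomial (Fin m) K} {i : Fin m}
    (hq : q.IsWeightedHomogeneous w (w i)) (hq0 : aeval f q = 0)
    (hc : coeff (Finsupp.single i 1) q ≠ 0) :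
    f i ∈ Algebra.adjoin K (f '' {j | j ≠ i}) := by
  classical
  set c := coeff (Finsupp.single i 1) q with hcdef
  have h1 : q - C c * X i ∈ supported K {j | j ≠ i} := by
    refine mem_supported_of_forall fun μ hμ j hj => ?_
    rintro rfl
    rw [coeff_sub, coeff_C_mul, coeff_X] at hμ
    by_cases hμj : Finsupp.single j 1 = μ
    · subst hμj
      simp [hcdef] at hμ
    · rw [if_neg hμj, mul_zero, sub_zero] at hμ
      exact hμj (eq_single_of_weight hw hj (hq hμ).le).symm
  have h2 := aeval_mem_adjoin_of_mem_supported (f := f) h1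
  rw [map_sub, hq0, map_mul, aeval_X, aeval_C, zero_sub, ← Algebra.smul_def] at h2
  have h3 := Subalgebra.smul_mem _ h2 (-c⁻¹)
  rwa [neg_smul, smul_neg, neg_neg, smul_smul, inv_mul_cancel₀ hc, one_smul] at h3

/-- Relations between minimal generators have no linear terms. -/
theorem IsMinimalGenerators.coeff_single_eq_zero [SetLike.GradedMonoid 𝒜]
    (hA : IndependentGrading 𝒜) (h0 : ∀ x ∈ 𝒜 0, ∃ c : K, x = algebraMap K A c) {m : ℕ}
    {f : Fin m → A} {w : Fin m → ℕ} (h : IsMinimalGenerators 𝒜 f w) {p : MvPolynomial (Fin m) K}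
    (hp : aeval f p = 0) (i : Fin m) : coeff (Finsupp.single i 1) p = 0 := by
  classical
  by_contra hc
  refine h.irredundant i (mem_adjoin_of_coeff_single_ne_zero (h.weight_pos h0)
    (weightedHomogeneousComponent_isWeightedHomogeneous (w i) p) ?_ ?_)
  · rw [aeval_weightedHomogeneousComponent hA h.homogeneous (hp ▸ Submodule.zero_mem _), hp]
  · rw [coeff_weightedHomogeneousComponent, if_pos (by simp [Finsupp.weight_single])]
    exact hc

/-- Since `θ (X i) - X i` is a relation, it has no linear terms, and by weight it involves only
variables of weight below `w i`. Induction on the weight puts every variable in the range. -/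
theorem IsMinimalGenerators.surjective_endomorphism [SetLike.GradedMonoid 𝒜]
    (hA : IndependentGrading 𝒜) (h0 : ∀ x ∈ 𝒜 0, ∃ c : K, x = algebraMap K A c) {m : ℕ}
    {f : Fin m → A} {w : Fin m → ℕ} (h : IsMinimalGenerators 𝒜 f w)
    (θ : MvPolynomial (Fin m) K →ₐ[K] MvPolynomial (Fin m) K)
    (hθ : ∀ i, (θ (X i)).IsWeightedHomogeneous w (w i)) (hθf : ∀ p, aeval f (θ p) = aeval f p) :
    Function.Surjective θ := by
  have hw := h.weight_pos h0
  have key : ∀ d i, w i = d → X i ∈ θ.range := by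
    intro d
    induction d using Nat.strong_induction_on with
    | _ d ih =>
      rintro i rfl
      have hq : θ (X i) - X i ∈ supported K {j | w j < w i} := by
        refine mem_supported_of_forall fun μ hμ j hj => ?_
        have hwt : Finsupp.weight w μ = w i :=
          ((hθ i).sub (isWeightedHomogeneous_X K w i)) hμ
        by_contra hlt
        have := eq_single_of_weight hw hj (by rw [hwt]; exact not_lt.1 hlt)
        rw [this] at hμ
        exact hμ (h.coeff_single_eq_zero hA h0 (by rw [map_sub, hθf, sub_self]) j)
      have hle : supported K {j | w j < w i} ≤ θ.range := by
        rw [supported_eq_adjoin_X, Algebra.adjoin_le_iff]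
        rintro _ ⟨j, hj, rfl⟩
        exact ih _ hj j rfl
      have := θ.range.sub_mem ⟨X i, rfl⟩ (hle hq)
      rwa [show θ.toRingHom (X i) - (θ (X i) - X i) = X i from sub_sub_cancel _ _] at this
  rw [← AlgHom.range_eq_top, eq_top_iff, ← adjoin_range_X, Algebra.adjoin_le_iff]
  rintro _ ⟨i, rfl⟩
  exact key _ i rfl

theorem IsMinimalGenerators.exists_lift [SetLike.GradedMonoid 𝒜]
    (hA : IndependentGrading 𝒜) {m n : ℕ}
    {f : Fin m → A} {w : Fin m → ℕ} (hf : IsMinimalGenerators 𝒜 f w)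
    {g : Fin n → A} {v : Fin n → ℕ} (hg : IsMinimalGenerators 𝒜 g v) :
    ∃ β : MvPolynomial (Fin n) K →ₐ[K] MvPolynomial (Fin m) K,
      (∀ e p, p.IsWeightedHomogeneous v e → (β p).IsWeightedHomogeneous w e) ∧
      ∀ p, aeval f (β p) = aeval g p := by
  have h1 : ∀ j, ∃ p : MvPolynomial (Fin m) K, p.IsWeightedHomogeneous w (v j) ∧
      aeval f p = g j := by
    intro j
    obtain ⟨p, hp⟩ := hf.surjective (g j)
    exact ⟨_, weightedHomogeneousComponent_isWeightedHomogeneous (v j) p, by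
      rw [aeval_weightedHomogeneousComponent hA hf.homogeneous (hp ▸ hg.homogeneous j), hp]⟩
  choose b hb hbg using h1
  refine ⟨aeval b, fun e p hp => ?_, fun p => ?_⟩
  · have := WeightedHomogeneousSubmodule.gradedMonoid (R := K) (w := w)
    exact aeval_mem_graded (𝒜 := weightedHomogeneousSubmodule K w) hb hp
  · rw [← AlgHom.comp_apply, comp_aeval]
    simp only [hbg]

/-- Minimal systems of homogeneous generators differ by an automorphism of graded polynomial
rings. -/
theorem IsMinimalGenerators.exists_bijective_lift [SetLike.GradedMonoid 𝒜]
    (hA : IndependentGrading 𝒜) (h0 : ∀ x ∈ 𝒜 0, ∃ c : K, x = algebraMap K A c) {m n : ℕ}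
    {f : Fin m → A} {w : Fin m → ℕ} (hf : IsMinimalGenerators 𝒜 f w)
    {g : Fin n → A} {v : Fin n → ℕ} (hg : IsMinimalGenerators 𝒜 g v) :
    ∃ β : MvPolynomial (Fin n) K ≃ₐ[K] MvPolynomial (Fin m) K,
      (∀ e p, p.IsWeightedHomogeneous v e → (β p).IsWeightedHomogeneous w e) ∧
      ∀ p, aeval f (β p) = aeval g p := by
  obtain ⟨β, hβ, hβf⟩ := hf.exists_lift hA hg
  -- Both composites of the two lifts are compatible with the maps to `A`, hence surjective; over a
  -- Noetherian ring `α ∘ β` is then injective too.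
  obtain ⟨α, hα, hαg⟩ := hg.exists_lift hA hf
  have h1 := hf.surjective_endomorphism hA h0 (β.comp α)
    (fun i => hβ _ _ (hα _ _ (isWeightedHomogeneous_X K w i)))
    (fun p => by rw [AlgHom.comp_apply, hβf, hαg])
  have h2 := hg.surjective_endomorphism hA h0 (α.comp β)
    (fun i => hα _ _ (hβ _ _ (isWeightedHomogeneous_X K v i)))
    (fun p => by rw [AlgHom.comp_apply, hαg, hβf])
  have h3 := injective_of_surjective_ringEndomorphism (α.comp β).toRingHom h2
  have hinj : Function.Injective β := fun x y hxy => h3 (by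
    change α (β x) = α (β y); rw [hxy])
  have hsurj : Function.Surjective β := fun x => by
    obtain ⟨y, hy⟩ := h1 x
    exact ⟨α y, hy⟩
  exact ⟨AlgEquiv.ofBijective β ⟨hinj, hsurj⟩, hβ, hβf⟩

end Generators

end BinaryInvariants

namespace BinaryInvariants

/-! ### Explicit invariants of two binary cubics and their relations. -/

section Cubics

variable {S : Type*} [CommRing S]

/-- The discriminant of a binary cubic form. -/
def cubicDisc (a : Fin 4 → S) : S :=
  a 1 ^ 2 * a 2 ^ 2 - 4 * a 0 * a 2 ^ 3 - 4 * a 1 ^ 3 * a 3 + 18 * a 0 * a 1 * a 2 * a 3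
    - 27 * a 0 ^ 2 * a 3 ^ 2

/-- The part of `cubicDisc (a + b)` of bidegree `(3, 1)`. -/
def cubicDisc₁ (a b : Fin 4 → S) : S :=
  2 * a 1 * a 2 ^ 2 * b 1 + 2 * a 1 ^ 2 * a 2 * b 2 - 4 * (b 0 * a 2 ^ 3 + 3 * a 0 * a 2 ^ 2 * b 2)
    - 4 * (3 * a 1 ^ 2 * b 1 * a 3 + a 1 ^ 3 * b 3)
    + 18 * (b 0 * a 1 * a 2 * a 3 + a 0 * b 1 * a 2 * a 3 + a 0 * a 1 * b 2 * a 3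
      + a 0 * a 1 * a 2 * b 3)
    - 54 * (a 0 * b 0 * a 3 ^ 2 + a 0 ^ 2 * a 3 * b 3)

/-- The part of `cubicDisc (a + b)` of bidegree `(2, 2)`. -/
def cubicDisc₂ (a b : Fin 4 → S) : S :=
  a 1 ^ 2 * b 2 ^ 2 + 4 * a 1 * b 1 * a 2 * b 2 + b 1 ^ 2 * a 2 ^ 2
    - 12 * (a 0 * a 2 * b 2 ^ 2 + b 0 * a 2 ^ 2 * b 2)
    - 12 * (a 1 * b 1 ^ 2 * a 3 + a 1 ^ 2 * b 1 * b 3)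
    + 18 * (b 0 * b 1 * a 2 * a 3 + b 0 * a 1 * b 2 * a 3 + b 0 * a 1 * a 2 * b 3
      + a 0 * b 1 * b 2 * a 3 + a 0 * b 1 * a 2 * b 3 + a 0 * a 1 * b 2 * b 3)
    - 27 * (a 0 ^ 2 * b 3 ^ 2 + 4 * a 0 * b 0 * a 3 * b 3 + b 0 ^ 2 * a 3 ^ 2)

/-- The Hessian of a binary cubic form, up to a constant. -/
def cubicHessian (a : Fin 4 → S) : Fin 3 → S :=
  ![a 1 ^ 2 - 3 * a 0 * a 2, a 1 * a 2 - 9 * a 0 * a 3, a 2 ^ 2 - 3 * a 1 * a 3]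

/-- The contraction of a binary quadratic form and a binary cubic form, as a vector of the
plane. -/
def contraction (h : Fin 3 → S) (b : Fin 4 → S) : Fin 2 → S :=
  ![3 * h 0 * b 3 - h 1 * b 2 + h 2 * b 1, -(h 0 * b 2 - h 1 * b 1 + 3 * h 2 * b 0)]

/-- The endomorphism of the plane given by a binary quadratic form and the area form. -/
def quadraticEnd (h : Fin 3 → S) (x : Fin 2 → S) : Fin 2 → S :=
  ![h 1 * x 0 + 2 * h 2 * x 1, -(2 * h 0 * x 0 + h 1 * x 1)]

/-- The area form of the plane. -/
def area (x y : Fin 2 → S) : S := x 0 * y 1 - x 1 * y 0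

/-- The invariant bilinear form on binary cubic forms. -/
def cubicPairing (a b : Fin 4 → S) : S := 3 * a 0 * b 3 - a 1 * b 2 + a 2 * b 1 - 3 * a 3 * b 0

/-- The invariant of bidegree `(3, 3)`. -/
def cubicInvariant₆ (a b : Fin 4 → S) : S :=
  area (contraction (cubicHessian a) b) (contraction (cubicHessian b) a)

/-- The coefficients of the composition of the cubic form `a` with the linear map whose matrix
has the columns `x` and `y`. -/
def cubicComp (a : Fin 4 → S) (x y : Fin 2 → S) : Fin 4 → S :=
  ![a 0 * x 0 ^ 3 + a 1 * x 0 ^ 2 * x 1 + a 2 * x 0 * x 1 ^ 2 + a 3 * x 1 ^ 3,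
    3 * a 0 * x 0 ^ 2 * y 0 + a 1 * (x 0 ^ 2 * y 1 + 2 * x 0 * y 0 * x 1)
      + a 2 * (2 * x 0 * x 1 * y 1 + y 0 * x 1 ^ 2) + 3 * a 3 * x 1 ^ 2 * y 1,
    3 * a 0 * x 0 * y 0 ^ 2 + a 1 * (2 * x 0 * y 0 * y 1 + y 0 ^ 2 * x 1)
      + a 2 * (x 0 * y 1 ^ 2 + 2 * y 0 * x 1 * y 1) + 3 * a 3 * x 1 * y 1 ^ 2,
    a 0 * y 0 ^ 3 + a 1 * y 0 ^ 2 * y 1 + a 2 * y 0 * y 1 ^ 2 + a 3 * y 1 ^ 3]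

/-- The basic invariants of a pair of binary cubic forms. -/
def basicInvariant (i : Fin 7) (a b : Fin 4 → S) : S :=
  (![cubicDisc a, cubicDisc₁ a b, cubicDisc₂ a b, cubicDisc₁ b a, cubicDisc b, cubicPairing a b,
    cubicInvariant₆ a b] : Fin 7 → S) i

theorem map_basicInvariant {T : Type*} [CommRing T] (φ : S →+* T) (i : Fin 7) (a b : Fin 4 → S) :
    φ (basicInvariant i a b) = basicInvariant i (φ ∘ a) (φ ∘ b) := by
  fin_cases i <;> simp [basicInvariant, cubicDisc, cubicDisc₁, cubicDisc₂, cubicPairing, map_ofNat,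
    cubicInvariant₆, area, contraction, cubicHessian]

/-! ### Invariance -/

theorem cubicDisc_comp (a : Fin 4 → S) (x y : Fin 2 → S) :
    cubicDisc (cubicComp a x y) = area x y ^ 6 * cubicDisc a := by
  simp only [cubicDisc, cubicComp, area, Matrix.cons_val]
  ring

theorem cubicPairing_comp (a b : Fin 4 → S) (x y : Fin 2 → S) :
    cubicPairing (cubicComp a x y) (cubicComp b x y) = area x y ^ 3 * cubicPairing a b := by
  simp only [cubicPairing, cubicComp, area, Matrix.cons_val]
  ring

/-- By Cramer's rule the entries on the right are, up to a power of the area, the coordinates of the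
contraction in the frame `x`, `y`: it is a covariant vector. Once the Hessian is transformed, it may
be replaced by an arbitrary quadratic form. -/
theorem contraction_hessian_comp (a b : Fin 4 → S) (x y : Fin 2 → S) :
    contraction (cubicHessian (cubicComp a x y)) (cubicComp b x y) =
      ![area x y ^ 4 * area (contraction (cubicHessian a) b) y,
        area x y ^ 4 * area x (contraction (cubicHessian a) b)] := by
  have h : cubicHessian (cubicComp a x y) =
      ![area x y ^ 2 * (cubicHessian a 0 * x 0 ^ 2 + cubicHessian a 1 * x 0 * x 1
          + cubicHessian a 2 * x 1 ^ 2),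
        area x y ^ 2 * (2 * cubicHessian a 0 * x 0 * y 0 + cubicHessian a 1 * (x 0 * y 1 + x 1 * y 0)
          + 2 * cubicHessian a 2 * x 1 * y 1),
        area x y ^ 2 * (cubicHessian a 0 * y 0 ^ 2 + cubicHessian a 1 * y 0 * y 1
          + cubicHessian a 2 * y 1 ^ 2)] := by
    ext i
    fin_cases i <;> simp [cubicHessian, cubicComp, area] <;> ring
  rw [h]
  generalize cubicHessian a = h
  ext i
  fin_cases i <;> simp [contraction, cubicComp, area] <;> ring

theorem cubicInvariant₆_comp (a b : Fin 4 → S) (x y : Fin 2 → S) :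
    cubicInvariant₆ (cubicComp a x y) (cubicComp b x y) = area x y ^ 9 * cubicInvariant₆ a b := by
  simp only [cubicInvariant₆, contraction_hessian_comp]
  generalize contraction (cubicHessian a) b = u
  generalize contraction (cubicHessian b) a = v
  simp only [area, Matrix.cons_val]
  ring

theorem cubicDisc_add (a b : Fin 4 → S) (t : S) :
    cubicDisc (a + t • b) = cubicDisc a + t * cubicDisc₁ a b + t ^ 2 * cubicDisc₂ a b
      + t ^ 3 * cubicDisc₁ b a + t ^ 4 * cubicDisc b := by
  simp only [cubicDisc, cubicDisc₁, cubicDisc₂, Pi.add_apply, Pi.smul_apply, smul_eq_mul]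
  ring

theorem cubicComp_add (a b : Fin 4 → S) (t : S) (x y : Fin 2 → S) :
    cubicComp (a + t • b) x y = cubicComp a x y + t • cubicComp b x y := by
  ext i
  fin_cases i <;> simp [cubicComp] <;> ring

theorem basicInvariant_comp {K : Type*} [Field K] [CharZero K] (i : Fin 7) (a b : Fin 4 → K)
    (x y : Fin 2 → K) (h : area x y = 1) :
    basicInvariant i (cubicComp a x y) (cubicComp b x y) = basicInvariant i a b := by
  have hD : ∀ t : K, cubicDisc (cubicComp a x y + t • cubicComp b x y) = cubicDisc (a + t • b) :=
    fun t => by rw [← cubicComp_add, cubicDisc_comp, h, one_pow, one_mul]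
  simp only [cubicDisc_add] at hD
  -- A polynomial in `t` of degree 4 is determined by its values at 0, ±1, ±2; the rational weights
  -- below are the interpolation coefficients.
  have h0 := hD 0
  have h1 := hD 1
  have h2 := hD (-1)
  have h3 := hD 2
  have h4 := hD (-2)
  fin_cases i
  · change cubicDisc _ = cubicDisc _
    linear_combination h0
  · change cubicDisc₁ _ _ = cubicDisc₁ _ _
    linear_combination (2 / 3) * h1 - (2 / 3) * h2 - (1 / 12) * h3 + (1 / 12) * h4
  · change cubicDisc₂ _ _ = cubicDisc₂ _ _
    linear_combination - (5 / 4) * h0 + (2 / 3) * h1 + (2 / 3) * h2 - (1 / 24) * h3 - (1 / 24) * h4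
  · change cubicDisc₁ _ _ = cubicDisc₁ _ _
    linear_combination - (1 / 6) * h1 + (1 / 6) * h2 + (1 / 12) * h3 - (1 / 12) * h4
  · change cubicDisc _ = cubicDisc _
    rw [cubicDisc_comp, h, one_pow, one_mul]
  · change cubicPairing _ _ = cubicPairing _ _
    rw [cubicPairing_comp, h, one_pow, one_mul]
  · change cubicInvariant₆ _ _ = cubicInvariant₆ _ _
    rw [cubicInvariant₆_comp, h, one_pow, one_mul]

/-! ### Relations -/

/-- The relation of degree `8`. -/
def relation₈ (c : Fin 7 → S) : S :=
  c 2 ^ 2 - 3 * c 1 * c 3 + 12 * c 0 * c 4 - 8 * c 5 * c 6 - 9 * c 5 ^ 4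

/-- The relation of degree `12`. -/
def relation₁₂ (c : Fin 7 → S) : S :=
  72 * c 0 * c 2 * c 4 + 9 * c 1 * c 2 * c 3 - 27 * c 0 * c 3 ^ 2 - 27 * c 4 * c 1 ^ 2
    - 2 * c 2 ^ 3 - 16 * c 6 ^ 2 - 72 * c 5 ^ 3 * c 6 - 54 * c 5 ^ 6

/-- The terms in `c 0, ..., c 4` are the classical invariant I of the binary quartic disc(a + t b),
which the relation expresses through `c 5` and `c 6`. In `relation₁₂` the invariant J of the same
quartic plays this role. -/
theorem relation₈_basicInvariant (a b : Fin 4 → S) :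
    relation₈ (fun i => basicInvariant i a b) = 0 := by
  simp only [relation₈, basicInvariant, cubicDisc, cubicDisc₁, cubicDisc₂, cubicPairing,
    cubicInvariant₆, area, contraction, cubicHessian, Matrix.cons_val]
  ring

theorem relation₁₂_basicInvariant (a b : Fin 4 → S) :
    relation₁₂ (fun i => basicInvariant i a b) = 0 := by
  simp only [relation₁₂, basicInvariant, cubicDisc, cubicDisc₁, cubicDisc₂, cubicPairing,
    cubicInvariant₆, area, contraction, cubicHessian, Matrix.cons_val]
  ring

end Cubics

end BinaryInvariants

namespace BinaryInvariants

/-! ### Coefficients of the cubics in a frame of linear covariants. -/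

section Frame

variable {S : Type*} [CommRing S]

/-- The endomorphism `quadraticEnd h` has trace zero and square the scalar `h 1 ^ 2 - 4 * h 0 * h
2`. Hence, in the frame of `x` and its image, coefficients 2 and 3 reduce to coefficients 0 and 1 up
to a contraction term. -/
theorem cubicComp_quadraticEnd_two (h : Fin 3 → S) (b : Fin 4 → S) (x : Fin 2 → S) :
    cubicComp b x (quadraticEnd h x) 2 = 3 * (h 1 ^ 2 - 4 * h 0 * h 2) * cubicComp b x x 0
      - 2 * area x (quadraticEnd h x) * area (contraction h b) x := by
  simp only [cubicComp, quadraticEnd, area, contraction, Matrix.cons_val]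
  ring

theorem cubicComp_quadraticEnd_three (h : Fin 3 → S) (b : Fin 4 → S) (x : Fin 2 → S) :
    3 * cubicComp b x (quadraticEnd h x) 3 =
      (h 1 ^ 2 - 4 * h 0 * h 2) * cubicComp b x (quadraticEnd h x) 1
      - 2 * area x (quadraticEnd h x) * area (contraction h b) (quadraticEnd h x) := by
  simp only [cubicComp, quadraticEnd, area, contraction, Matrix.cons_val]
  ring

/-- A cubic is apolar to its own Hessian, so the contraction term disappears for the first form. -/
theorem contraction_cubicHessian_self (a : Fin 4 → S) : contraction (cubicHessian a) a = 0 := by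
  ext i
  fin_cases i <;> simp [contraction, cubicHessian] <;> ring

theorem disc_cubicHessian (a : Fin 4 → S) :
    cubicHessian a 1 ^ 2 - 4 * cubicHessian a 0 * cubicHessian a 2 = -3 * cubicDisc a := by
  simp only [cubicHessian, cubicDisc, Matrix.cons_val]
  ring

/-- The area of the frame used below, in terms of the basic invariants. -/
def frameArea (c : Fin 7 → S) : S := -3 * c 1 ^ 2 - 12 * c 0 * c 5 ^ 2 + 8 * c 0 * c 2

end Frame

section FrameField

variable {K : Type*} [Field K] [CharZero K]

theorem area_frame (a b : Fin 4 → K) :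
    area (contraction (cubicHessian a) b)
      (quadraticEnd (cubicHessian a) (contraction (cubicHessian a) b)) =
    3 / 8 * frameArea (fun i => basicInvariant i a b) := by
  simp only [frameArea, basicInvariant, cubicDisc, cubicDisc₁, cubicDisc₂, cubicPairing,
    area, contraction, cubicHessian, quadraticEnd, Matrix.cons_val]
  ring

/-- Coefficient 0 is the value at the first frame vector, so the second vector is arbitrary. -/
theorem cubicComp_frame_fst_zero (a b : Fin 4 → K) (y : Fin 2 → K) :
    cubicComp a (contraction (cubicHessian a) b) y 0 =
    (fun c : Fin 7 → K => 9 / 16 * c 1 ^ 2 * c 5 + c 0 * c 6 - 3 / 2 * c 0 * c 2 * c 5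
      + 9 / 4 * c 0 * c 5 ^ 3) (fun i => basicInvariant i a b) := by
  simp only [basicInvariant, cubicDisc, cubicDisc₁, cubicDisc₂, cubicPairing, cubicComp,
    cubicInvariant₆, area, contraction, cubicHessian, Matrix.cons_val]
  ring

theorem cubicComp_frame_fst_one (a b : Fin 4 → K) :
    cubicComp a (contraction (cubicHessian a) b)
      (quadraticEnd (cubicHessian a) (contraction (cubicHessian a) b)) 1 =
    (fun c : Fin 7 → K => 27 / 32 * c 1 ^ 3 - 27 / 8 * c 0 * c 1 * c 2 + 27 / 4 * c 0 ^ 2 * c 3)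
      (fun i => basicInvariant i a b) := by
  simp only [basicInvariant, cubicDisc, cubicDisc₁, cubicDisc₂, cubicComp,
    contraction, cubicHessian, quadraticEnd, Matrix.cons_val]
  ring

theorem cubicComp_frame_snd_zero (a b : Fin 4 → K) (y : Fin 2 → K) :
    cubicComp b (contraction (cubicHessian a) b) y 0 =
    (fun c : Fin 7 → K => 1 / 4 * c 1 * c 6 + 3 / 16 * c 1 * c 2 * c 5 + 9 / 16 * c 1 * c 5 ^ 3
      - 9 / 8 * c 0 * c 3 * c 5) (fun i => basicInvariant i a b) := by
  simp only [basicInvariant, cubicDisc, cubicDisc₁, cubicDisc₂, cubicPairing, cubicComp,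
    cubicInvariant₆, area, contraction, cubicHessian, Matrix.cons_val]
  ring

theorem cubicComp_frame_snd_one (a b : Fin 4 → K) :
    cubicComp b (contraction (cubicHessian a) b)
      (quadraticEnd (cubicHessian a) (contraction (cubicHessian a) b)) 1 =
    (fun c : Fin 7 → K => 27 / 32 * c 1 ^ 2 * c 5 ^ 2 + 9 / 32 * c 1 ^ 2 * c 2
      + 9 / 2 * c 0 * c 5 * c 6 + 27 / 4 * c 0 * c 5 ^ 4 - 9 / 4 * c 0 * c 2 * c 5 ^ 2
      - 3 / 2 * c 0 * c 2 ^ 2 + 27 / 16 * c 0 * c 1 * c 3) (fun i => basicInvariant i a b) := by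
  simp only [basicInvariant, cubicDisc, cubicDisc₁, cubicDisc₂, cubicPairing, cubicComp,
    cubicInvariant₆, area, contraction, cubicHessian, quadraticEnd, Matrix.cons_val]
  ring

end FrameField

end BinaryInvariants

namespace BinaryInvariants

open MvPolynomial

/-! ### Testing homogeneity by scaling the variables. -/

section Scaling

/-- The substitution multiplies a monomial of weight `n` by the `n`-th power of the new variable, so
weights are read off its exponents. Homogeneity of an explicit polynomial becomes a `ring` identity.
-/
theorem isWeightedHomogeneous_of_scaling {σ K : Type*} [CommRing K] {w : σ → ℕ}
    {p : MvPolynomial σ K} {d : ℕ}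
    (h : eval₂ (Polynomial.C.comp C) (fun s => Polynomial.X ^ w s * Polynomial.C (X s)) p =
      Polynomial.X ^ d * Polynomial.C p) : p.IsWeightedHomogeneous w d := by
  classical
  have key : ∀ (q : MvPolynomial σ K) (n : ℕ) (ν : σ →₀ ℕ),
      coeff ν ((eval₂ (Polynomial.C.comp C)
        (fun s => Polynomial.X ^ w s * Polynomial.C (X s)) q).coeff n) =
      if Finsupp.weight w ν = n then coeff ν q else 0 := by
    intro q n ν
    induction q using MvPolynomial.induction_on' with
    | monomial μ c =>
      rw [eval₂_monomial]
      have e : (μ.prod fun s k => (Polynomial.X ^ w s * Polynomial.C (X s : MvPolynomial σ K)) ^ k) =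
          Polynomial.X ^ (Finsupp.weight w μ) * Polynomial.C (monomial μ 1) := by
        rw [Finsupp.weight_apply, Finsupp.prod, Finsupp.sum, ← Finset.prod_pow_eq_pow_sum]
        simp only [mul_pow, Finset.prod_mul_distrib, ← map_pow, ← map_prod]
        congr 1
        · exact Finset.prod_congr rfl fun s _ => by rw [← pow_mul, smul_eq_mul, mul_comm]
        · rw [monomial_eq, C_1, one_mul]
          rfl
      rw [e, RingHom.comp_apply, mul_left_comm, ← map_mul, C_mul_monomial, mul_one,
        Polynomial.coeff_X_pow_mul', Polynomial.coeff_C]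
      by_cases hμ : μ = ν
      · subst hμ
        by_cases hn : Finsupp.weight w μ = n
        · simp [hn]
        · rw [if_neg hn]
          split_ifs with h1 h2
          · omega
          · simp
          · simp
      · have : coeff ν (monomial μ c) = 0 := by rw [coeff_monomial, if_neg hμ]
        split_ifs <;> simp [this]
    | add p q hp hq =>
      rw [eval₂_add, Polynomial.coeff_add, coeff_add, hp, hq, coeff_add]
      split_ifs <;> simp
  intro ν hν
  by_contra hne
  have h1 := key p (Finsupp.weight w ν) ν
  rw [h, if_pos rfl, Polynomial.coeff_X_pow_mul', Polynomial.coeff_C] at h1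
  apply hν
  rw [← h1]
  split_ifs with h2 h3
  · omega
  · simp
  · simp

end Scaling

/-! ### The action on cubics in coefficients. -/

section Action

variable {K : Type*} [Field K]

theorem coeff_binaryForm {d : ℕ} (a : Fin (d + 1) → K) (i : Fin (d + 1)) :
    coeff (Finsupp.single 0 (d - (i : ℕ)) + Finsupp.single 1 (i : ℕ)) (binaryForm a) = a i := by
  classical
  have key : ∀ (c : K) (p q : ℕ), C c * X 0 ^ p * X 1 ^ q
      = monomial (Finsupp.single (0 : Fin 2) p + Finsupp.single 1 q) c := by
    intro c p q
    rw [X_pow_eq_monomial, X_pow_eq_monomial, C_mul_monomial, monomial_mul]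
    simp
  unfold binaryForm
  simp only [key, coeff_sum, coeff_monomial]
  rw [Finset.sum_eq_single i]
  · simp
  · intro j _ hj
    rw [if_neg]
    intro h
    have := DFunLike.congr_fun h 1
    simp at this
    exact hj (Fin.ext this)
  · simp

theorem binaryForm_cubic (a : Fin (3 + 1) → K) : binaryForm a =
    C (a 0) * X 0 ^ 3 + C (a 1) * X 0 ^ 2 * X 1 + C (a 2) * X 0 * X 1 ^ 2 + C (a 3) * X 1 ^ 3 := by
  rw [binaryForm]
  refine (Fin.sum_univ_four _).trans ?_
  simp

theorem act_cubic (g : SL(2, K)) (a : Fin (3 + 1) → K) :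
    act g a = cubicComp a ![(g⁻¹ : SL(2, K)) 0 0, (g⁻¹ : SL(2, K)) 1 0]
      ![(g⁻¹ : SL(2, K)) 0 1, (g⁻¹ : SL(2, K)) 1 1] := by
  have h : linSubst g (binaryForm a) = binaryForm (d := 3)
      (cubicComp a ![(g⁻¹ : SL(2, K)) 0 0, (g⁻¹ : SL(2, K)) 1 0]
      ![(g⁻¹ : SL(2, K)) 0 1, (g⁻¹ : SL(2, K)) 1 1]) := by
    have h0 : linSubst g (X 0) = C ((g⁻¹ : SL(2, K)) 0 0) * X 0 + C ((g⁻¹ : SL(2, K)) 0 1) * X 1 := by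
      rw [linSubst, aeval_X, Fin.sum_univ_two]
    have h1 : linSubst g (X 1) = C ((g⁻¹ : SL(2, K)) 1 0) * X 0 + C ((g⁻¹ : SL(2, K)) 1 1) * X 1 := by
      rw [linSubst, aeval_X, Fin.sum_univ_two]
    have hC : ∀ c, linSubst g (C c) = C c := fun c => (linSubst g).commutes c
    rw [binaryForm_cubic, binaryForm_cubic]
    simp only [map_add, map_mul, map_pow, h0, h1, hC]
    generalize (g⁻¹ : SL(2, K)) 0 0 = p
    generalize (g⁻¹ : SL(2, K)) 0 1 = q
    generalize (g⁻¹ : SL(2, K)) 1 0 = r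
    generalize (g⁻¹ : SL(2, K)) 1 1 = t
    simp only [cubicComp, Matrix.cons_val, map_add, map_mul, map_pow, map_ofNat]
    ring
  ext i
  unfold act
  rw [h, coeff_binaryForm]

theorem area_inv (g : SL(2, K)) : area ![(g⁻¹ : SL(2, K)) 0 0, (g⁻¹ : SL(2, K)) 1 0]
      ![(g⁻¹ : SL(2, K)) 0 1, (g⁻¹ : SL(2, K)) 1 1] = 1 := by
  have := Matrix.SpecialLinearGroup.det_coe (g⁻¹)
  rw [Matrix.det_fin_two] at this
  simp only [area, Matrix.cons_val]
  linear_combination this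

end Action

/-! ### The basic invariants as homogeneous elements of the algebra of invariants. -/

section Basic

variable (K : Type*) [Field K]

/-- The basic invariants as polynomials. -/
noncomputable def basicPolynomial (i : Fin 7) : MvPolynomial (Fin 2 × Fin (3 + 1)) K :=
  basicInvariant i (fun k => X (0, k)) (fun k => X (1, k))

variable {K}

theorem eval_basicPolynomial (z : Fin 2 × Fin (3 + 1) → K) (i : Fin 7) :
    eval z (basicPolynomial K i) = basicInvariant i (fun k => z (0, k)) (fun k => z (1, k)) := by
  rw [basicPolynomial, map_basicInvariant]
  congr 1 <;> ext k <;> simp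

/-- The degrees of the basic invariants. -/
def basicDegree : Fin 7 → ℕ := ![4, 4, 4, 4, 4, 2, 6]

theorem basicInvariant_smul {S : Type*} [CommRing S] (t : S) (i : Fin 7) (a b : Fin 4 → S) :
    basicInvariant i (fun k => t * a k) (fun k => t * b k) =
      t ^ basicDegree i * basicInvariant i a b := by
  fin_cases i <;> simp [basicInvariant, cubicDisc, cubicDisc₁, cubicDisc₂, cubicPairing,
    cubicInvariant₆, area, contraction, cubicHessian, basicDegree] <;> ring

theorem basicPolynomial_isHomogeneous (i : Fin 7) :
    (basicPolynomial K i).IsHomogeneous (basicDegree i) := by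
  refine isWeightedHomogeneous_of_scaling ?_
  rw [← coe_eval₂Hom, basicPolynomial, map_basicInvariant, map_basicInvariant,
    ← basicInvariant_smul]
  congr 1 <;> ext1 k <;> simp

theorem relation_map {S T : Type*} [CommRing S] [CommRing T] (φ : S →+* T) (c : Fin 7 → S) :
    φ (relation₈ c) = relation₈ (φ ∘ c) ∧ φ (relation₁₂ c) = relation₁₂ (φ ∘ c) ∧
      φ (frameArea c) = frameArea (φ ∘ c) := by
  simp [relation₈, relation₁₂, frameArea, map_ofNat]

theorem relation₈_isWeightedHomogeneous :
    (relation₈ (X : Fin 7 → MvPolynomial (Fin 7) K)).IsWeightedHomogeneous basicDegree 8 := by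
  refine isWeightedHomogeneous_of_scaling ?_
  rw [← coe_eval₂Hom, (relation_map _ _).1, (relation_map Polynomial.C _).1]
  simp [relation₈, basicDegree]
  ring

theorem relation₁₂_isWeightedHomogeneous :
    (relation₁₂ (X : Fin 7 → MvPolynomial (Fin 7) K)).IsWeightedHomogeneous basicDegree 12 := by
  refine isWeightedHomogeneous_of_scaling ?_
  rw [← coe_eval₂Hom, (relation_map _ _).2.1, (relation_map Polynomial.C _).2.1]
  simp [relation₁₂, basicDegree]
  ring

theorem frameArea_isWeightedHomogeneous :
    (frameArea (X : Fin 7 → MvPolynomial (Fin 7) K)).IsWeightedHomogeneous basicDegree 8 := by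
  refine isWeightedHomogeneous_of_scaling ?_
  rw [← coe_eval₂Hom, (relation_map _ _).2.2, (relation_map Polynomial.C _).2.2]
  simp [frameArea, basicDegree]
  ring

instance : SetLike.GradedMonoid (invariantsOfDegree K 2 3) where
  one_mem := isHomogeneous_one _ _
  mul_mem _ _ _ _ h₁ h₂ := IsHomogeneous.mul h₁ h₂

theorem independentGrading_invariants : IndependentGrading (invariantsOfDegree K 2 3) := by
  intro s x hx d hd hs
  have h1 : ∀ e, (x e : MvPolynomial (Fin 2 × Fin (3 + 1)) K).IsHomogeneous e := hx
  have h2 : (∑ e ∈ s, (x e : MvPolynomial (Fin 2 × Fin (3 + 1)) K)).IsHomogeneous d := by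
    have : (((∑ e ∈ s, x e : invariants K 2 3) : MvPolynomial (Fin 2 × Fin (3 + 1)) K)).IsHomogeneous
      d := hs
    rwa [AddSubmonoidClass.coe_finsetSum] at this
  apply Subtype.ext
  have h3 := homogeneousComponent_eq_self h2
  rw [map_sum, Finset.sum_eq_single d] at h3
  · rw [AddSubmonoidClass.coe_finsetSum, ← h3, homogeneousComponent_eq_self (h1 d)]
  · intro e _ hed
    rw [homogeneousComponent_of_mem (h1 e), if_neg hed.symm]
  · exact fun h => absurd hd h

theorem exists_eq_algebraMap_of_mem_zero (x : invariants K 2 3)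
    (hx : x ∈ invariantsOfDegree K 2 3 0) : ∃ c : K, x = algebraMap K _ c := by
  have h : (x : MvPolynomial (Fin 2 × Fin (3 + 1)) K).IsHomogeneous 0 := hx
  refine ⟨coeff 0 (x : MvPolynomial (Fin 2 × Fin (3 + 1)) K), Subtype.ext ?_⟩
  change _ = C _
  rw [← homogeneousComponent_zero, homogeneousComponent_eq_self h]

variable [CharZero K]

theorem basicPolynomial_mem (i : Fin 7) : basicPolynomial K i ∈ invariants K 2 3 := by
  intro g a
  rw [eval_basicPolynomial, eval_basicPolynomial]
  simp only [act_cubic]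
  exact basicInvariant_comp i _ _ _ _ (area_inv g)

variable (K) in
/-- The basic invariants as elements of the algebra of invariants. -/
noncomputable def basic (i : Fin 7) : invariants K 2 3 := ⟨basicPolynomial K i, basicPolynomial_mem i⟩

theorem basic_mem (i : Fin 7) : basic K i ∈ invariantsOfDegree K 2 3 (basicDegree i) :=
  basicPolynomial_isHomogeneous i

end Basic

end BinaryInvariants

namespace BinaryInvariants

open MvPolynomial

/-! ### Invariants as fractions in the basic invariants. -/

section Localization

variable {K : Type*} [Field K] [CharZero K]

/-- The values of the basic invariants at a point. -/
def basicValue (z : Fin 2 × Fin (3 + 1) → K) (i : Fin 7) : K :=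
  basicInvariant i (fun k => z (0, k)) (fun k => z (1, k))

variable (K) in
/-- The coefficients of the two cubic forms in the frame of linear covariants, in terms of the
basic invariants. -/
noncomputable def frameCoeff (s : Fin 2 × Fin (3 + 1)) : MvPolynomial (Fin 7) K :=
  let a₀ : MvPolynomial (Fin 7) K := C (9 / 16) * X 1 ^ 2 * X 5 + X 0 * X 6
    - C (3 / 2) * X 0 * X 2 * X 5 + C (9 / 4) * X 0 * X 5 ^ 3
  let a₁ : MvPolynomial (Fin 7) K :=
    C (27 / 32) * X 1 ^ 3 - C (27 / 8) * X 0 * X 1 * X 2 + C (27 / 4) * X 0 ^ 2 * X 3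
  let b₀ : MvPolynomial (Fin 7) K := C (1 / 4) * X 1 * X 6 + C (3 / 16) * X 1 * X 2 * X 5
    + C (9 / 16) * X 1 * X 5 ^ 3 - C (9 / 8) * X 0 * X 3 * X 5
  let b₁ : MvPolynomial (Fin 7) K := C (27 / 32) * X 1 ^ 2 * X 5 ^ 2 + C (9 / 32) * X 1 ^ 2 * X 2
      + C (9 / 2) * X 0 * X 5 * X 6 + C (27 / 4) * X 0 * X 5 ^ 4 - C (9 / 4) * X 0 * X 2 * X 5 ^ 2
      - C (3 / 2) * X 0 * X 2 ^ 2 + C (27 / 16) * X 0 * X 1 * X 3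
  (![![a₀, a₁, -9 * X 0 * a₀, -X 0 * a₁],
    ![b₀, b₁, -9 * X 0 * b₀, -X 0 * b₁ - C (3 / 32) * frameArea X ^ 2]] :
    Fin 2 → Fin 4 → MvPolynomial (Fin 7) K) s.1 s.2

theorem eval_frameCoeff (z : Fin 2 × Fin (3 + 1) → K) (s : Fin 2 × Fin (3 + 1)) :
    eval (basicValue z) (frameCoeff K s) =
      cubicComp (fun k => z (s.1, k)) (contraction (cubicHessian fun k => z (0, k)) fun k => z (1, k))
        (quadraticEnd (cubicHessian fun k => z (0, k))
          (contraction (cubicHessian fun k => z (0, k)) fun k => z (1, k))) s.2 := by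
  set a : Fin 4 → K := fun k => z (0, k) with ha
  set b : Fin 4 → K := fun k => z (1, k) with hb
  set u := contraction (cubicHessian a) b with hu
  have hv : basicValue z = fun i => basicInvariant i a b := rfl
  have h0 : basicValue z 0 = cubicDisc a := rfl
  have hs := area_frame a b
  rw [← hv, ← hu] at hs
  have ha0 := cubicComp_frame_fst_zero a b (quadraticEnd (cubicHessian a) u)
  have ha0' := cubicComp_frame_fst_zero a b u
  have ha1 := cubicComp_frame_fst_one a b
  have hb0 := cubicComp_frame_snd_zero a b (quadraticEnd (cubicHessian a) u)
  have hb0' := cubicComp_frame_snd_zero a b u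
  have hb1 := cubicComp_frame_snd_one a b
  rw [← hv, ← hu] at ha0 ha1 hb0 hb1 ha0' hb0'
  have ha2 := cubicComp_quadraticEnd_two (cubicHessian a) a u
  have ha3 := cubicComp_quadraticEnd_three (cubicHessian a) a u
  have hb2 := cubicComp_quadraticEnd_two (cubicHessian a) b u
  have hb3 := cubicComp_quadraticEnd_three (cubicHessian a) b u
  have hz : ∀ y : Fin 2 → K, area 0 y = 0 := fun y => by simp [area]
  have huu : area u u = 0 := by simp only [area]; ring
  -- For the first form the contraction is 0. For the second it is `u`: the term with `area u u`
  -- vanishes, while the one with the frame area produces the square of `frameArea` in the last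
  -- coefficient.
  rw [disc_cubicHessian, ← h0, contraction_cubicHessian_self, hz, ha0'] at ha2
  rw [disc_cubicHessian, ← h0, contraction_cubicHessian_self, hz, ha1] at ha3
  rw [disc_cubicHessian, ← h0, ← hu, huu, hb0'] at hb2
  rw [disc_cubicHessian, ← h0, ← hu, hs, hb1] at hb3
  have hf : eval (basicValue z) (frameArea X) = frameArea (basicValue z) := by
    rw [(relation_map _ _).2.2]
    congr 1
    ext i
    simp
  obtain ⟨j, i⟩ := s
  have h3 : (3 : K) ≠ 0 := by norm_num
  fin_cases j
  · change _ = cubicComp a u _ i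
    fin_cases i
    · change _ = cubicComp a u _ 0
      rw [ha0]
      simp [frameCoeff]
    · change _ = cubicComp a u _ 1
      rw [ha1]
      simp [frameCoeff]
    · change _ = cubicComp a u _ 2
      rw [ha2]
      simp [frameCoeff, -mul_eq_mul_left_iff, -mul_eq_mul_right_iff]
      ring
    · change _ = cubicComp a u _ 3
      apply mul_left_cancel₀ h3
      rw [ha3]
      simp [frameCoeff, -mul_eq_mul_left_iff, -mul_eq_mul_right_iff]
      ring
  · change _ = cubicComp b u _ i
    fin_cases i
    · change _ = cubicComp b u _ 0
      rw [hb0]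
      simp [frameCoeff]
    · change _ = cubicComp b u _ 1
      rw [hb1]
      simp [frameCoeff]
    · change _ = cubicComp b u _ 2
      rw [hb2]
      simp [frameCoeff, -mul_eq_mul_left_iff, -mul_eq_mul_right_iff]
      ring
    · change _ = cubicComp b u _ 3
      apply mul_left_cancel₀ h3
      rw [hb3]
      simp [frameCoeff, hf]
      ring

theorem cubicComp_smul_snd {S : Type*} [CommRing S] (a : Fin 4 → S) (x y : Fin 2 → S) (t : S)
    (i : Fin 4) : cubicComp a x ![y 0 * t, y 1 * t] i = cubicComp a x y i * t ^ (i : ℕ) := by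
  fin_cases i <;> simp [cubicComp] <;> ring

/-- In the frame of linear covariants an invariant is a function of the basic invariants. -/
theorem eval_eq_eval_frameCoeff {F : MvPolynomial (Fin 2 × Fin (3 + 1)) K}
    (hF : F ∈ invariants K 2 3) {z : Fin 2 × Fin (3 + 1) → K}
    (hz : frameArea (basicValue z) ≠ 0) :
    eval z F = eval (fun s => eval (basicValue z) (frameCoeff K s) *
      ((3 / 8 * frameArea (basicValue z))⁻¹) ^ (s.2 : ℕ)) F := by
  set a : Fin 4 → K := fun k => z (0, k) with ha
  set b : Fin 4 → K := fun k => z (1, k) with hb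
  set u := contraction (cubicHessian a) b with hu
  set u' := quadraticEnd (cubicHessian a) u with hu'
  have hs : area u u' = 3 / 8 * frameArea (basicValue z) := area_frame a b
  set r := 3 / 8 * frameArea (basicValue z) with hr
  have hr0 : r ≠ 0 := mul_ne_zero (by norm_num) hz
  -- Only the second frame vector is divided by the area `r`: the determinant becomes 1 and
  -- coefficient `i` is divided by `r ^ i`. The action substitutes the inverse, so invariance is
  -- used for `M⁻¹`.
  let M : SL(2, K) := ⟨!![u 0, u' 0 * r⁻¹; u 1, u' 1 * r⁻¹], by
    rw [Matrix.det_fin_two_of]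
    have : u 0 * u' 1 - u 1 * u' 0 = r := hs
    field_simp
    linear_combination this⟩
  have h := hF M⁻¹ (fun j k => z (j, k))
  refine h.symm.trans ?_
  congr 2
  ext ⟨j, i⟩
  rw [act_cubic, inv_inv, eval_frameCoeff, ← cubicComp_smul_snd]
  rfl

theorem exists_frameArea_pow_mul (F : MvPolynomial (Fin 2 × Fin (3 + 1)) K) :
    ∃ (N : ℕ) (H : MvPolynomial (Fin 7) K), ∀ z : Fin 2 × Fin (3 + 1) → K,
      frameArea (basicValue z) ≠ 0 →
      frameArea (basicValue z) ^ N * eval (fun s => eval (basicValue z) (frameCoeff K s) *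
        ((3 / 8 * frameArea (basicValue z))⁻¹) ^ (s.2 : ℕ)) F = eval (basicValue z) H := by
  have hf : ∀ z : Fin 2 × Fin (3 + 1) → K,
      eval (basicValue z) (frameArea X) = frameArea (basicValue z) := fun z => by
    rw [(relation_map _ _).2.2]
    congr 1
    ext i
    simp
  induction F using MvPolynomial.induction_on with
  | C c => exact ⟨0, C c, fun z _ => by simp⟩
  | add p q hp hq =>
    obtain ⟨N₁, H₁, h₁⟩ := hp
    obtain ⟨N₂, H₂, h₂⟩ := hq
    refine ⟨N₁ + N₂, frameArea X ^ N₂ * H₁ + frameArea X ^ N₁ * H₂, fun z hz => ?_⟩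
    rw [map_add, map_add, map_mul, map_mul, map_pow, map_pow, hf, ← h₁ z hz, ← h₂ z hz]
    ring
  | mul_X p s hp =>
    obtain ⟨N, H, h⟩ := hp
    refine ⟨N + s.2, C ((8 / 3) ^ (s.2 : ℕ)) * H * frameCoeff K s, fun z hz => ?_⟩
    rw [map_mul, map_mul, map_mul, ← h z hz, eval_X, eval_C, pow_add]
    have hpow : frameArea (basicValue z) ^ (s.2 : ℕ) *
        ((3 / 8 * frameArea (basicValue z))⁻¹) ^ (s.2 : ℕ) = (8 / 3) ^ (s.2 : ℕ) := by
      rw [← mul_pow]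
      congr 1
      field_simp
    rw [← hpow]
    ring

/-- Invariants are polynomials in the basic invariants after multiplication by a power of the
area of the frame of linear covariants. -/
theorem exists_frameArea_pow_mul_eq {F : MvPolynomial (Fin 2 × Fin (3 + 1)) K}
    (hF : F ∈ invariants K 2 3) : ∃ (N : ℕ) (H : MvPolynomial (Fin 7) K),
      ∀ z : Fin 2 × Fin (3 + 1) → K,
        frameArea (basicValue z) ^ N * eval z F = eval (basicValue z) H := by
  obtain ⟨N, H, h⟩ := exists_frameArea_pow_mul F
  -- The extra factor makes both sides vanish where `frameArea` does, so the identity holds at every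
  -- point.
  refine ⟨N + 1, frameArea X * H, fun z => ?_⟩
  rw [map_mul, (relation_map _ _).2.2]
  have hf : (eval (basicValue z)) ∘ (X : Fin 7 → MvPolynomial (Fin 7) K) = basicValue z := by
    ext i
    simp
  rw [hf]
  by_cases hz : frameArea (basicValue z) = 0
  · rw [hz]
    simp
  · rw [← h z hz, ← eval_eq_eval_frameCoeff hF hz]
    ring

/-- Exchange of the two cubic forms, on the basic invariants. -/
def basicSwap {S : Type*} [CommRing S] (c : Fin 7 → S) : Fin 7 → S :=
  ![c 4, c 3, c 2, c 1, c 0, -c 5, -c 6]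

theorem basicValue_swap {K : Type*} [Field K] (z : Fin 2 × Fin (3 + 1) → K) :
    basicValue (fun s => z (Equiv.swap 0 1 s.1, s.2)) = basicSwap (basicValue z) := by
  have h : ∀ (i : Fin 7) (a b : Fin 4 → K),
      basicInvariant i b a = basicSwap (fun i => basicInvariant i a b) i := by
    intro i a b
    fin_cases i <;> simp [basicInvariant, basicSwap, cubicDisc₂, cubicPairing, cubicInvariant₆,
      area] <;> ring
  ext i
  rw [basicValue]
  simp only [Equiv.swap_apply_left, Equiv.swap_apply_right]
  exact h i _ _

/-- The previous result applied to `F` with the two forms exchanged supplies a second denominator.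
-/
theorem exists_frameArea_swap_pow_mul_eq {F : MvPolynomial (Fin 2 × Fin (3 + 1)) K}
    (hF : F ∈ invariants K 2 3) : ∃ (N : ℕ) (H : MvPolynomial (Fin 7) K),
      ∀ z : Fin 2 × Fin (3 + 1) → K,
        frameArea (basicSwap (basicValue z)) ^ N * eval z F = eval (basicValue z) H := by
  let σ : Fin 2 × Fin (3 + 1) → Fin 2 × Fin (3 + 1) := fun s => (Equiv.swap 0 1 s.1, s.2)
  have hσ : ∀ s, σ (σ s) = s := fun s => by simp [σ]
  have hF' : rename σ F ∈ invariants K 2 3 := by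
    intro g a
    rw [eval_rename, eval_rename]
    exact hF g fun j => a (Equiv.swap 0 1 j)
  obtain ⟨N, H, h⟩ := exists_frameArea_pow_mul_eq hF'
  refine ⟨N, aeval (basicSwap X) H, fun z => ?_⟩
  have h1 := h (z ∘ σ)
  have h2 : basicValue (z ∘ σ) = basicSwap (basicValue z) := basicValue_swap z
  rw [h2, eval_rename] at h1
  have h3 : (z ∘ σ) ∘ σ = z := _root_.funext fun s => congrArg z (hσ s)
  rw [h3] at h1
  rw [h1, ← coe_aeval_eq_eval, ← coe_aeval_eq_eval]
  change _ = (aeval (basicValue z)) (aeval (basicSwap X) H)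
  have h4 : basicSwap (basicValue z) = fun i => aeval (basicValue z)
      (basicSwap (X : Fin 7 → MvPolynomial (Fin 7) K) i) := by
    ext i
    fin_cases i <;> simp [basicSwap]
  rw [← AlgHom.comp_apply, comp_aeval, h4]
  rfl

end Localization

end BinaryInvariants

namespace BinaryInvariants

open MvPolynomial

/-! ### Regular sequences containing the relations and the denominators. -/

section RegularSequences

variable {K : Type*} [Field K]

theorem RegMod.pow {A : Type*} [CommRing A] {J : Ideal A} {a : A} (h : RegMod J a) (n : ℕ) :
    RegMod J (a ^ n) := by
  induction n with
  | zero => exact fun p hp => by simpa using hp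
  | succ n ih => exact fun p hp => ih p (h _ (by rwa [pow_succ', mul_assoc] at hp))

theorem RegSeq.perm_map {K A : Type*} [CommRing K] [CommRing A] [Algebra K A]
    (𝒜 : ℕ → Submodule K A) [GradedAlgebra 𝒜] {n : ℕ} {f : Fin n → A}
    (hf : ∀ i, ∃ d, 0 < d ∧ f i ∈ 𝒜 d) {l l' : List (Fin n)} (hl : l.Perm l')
    (H : RegSeq ⊥ (l.map f)) : RegSeq ⊥ (l'.map f) := by
  refine RegSeq.perm 𝒜 (hl.map f) (Ideal.IsHomogeneous.bot 𝒜) ?_ H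
  intro a ha
  obtain ⟨i, -, rfl⟩ := List.mem_map.1 ha
  exact hf i

theorem frameArea_basicSwap_isWeightedHomogeneous :
    (frameArea (basicSwap (X : Fin 7 → MvPolynomial (Fin 7) K))).IsWeightedHomogeneous
      basicDegree 8 := by
  refine isWeightedHomogeneous_of_scaling ?_
  rw [← coe_eval₂Hom, (relation_map _ _).2.2, (relation_map Polynomial.C _).2.2]
  simp [frameArea, basicDegree, basicSwap]
  ring

theorem exists_degree_X (i : Fin 7) : ∃ d, 0 < d ∧
    (X i : MvPolynomial (Fin 7) K) ∈ weightedHomogeneousSubmodule K basicDegree d :=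
  ⟨basicDegree i, by fin_cases i <;> decide, isWeightedHomogeneous_X K basicDegree i⟩

theorem relations_degrees (i : Fin 7) : ∃ d, 0 < d ∧
    (![X 0, X 1, X 5, X 4, relation₈ X, relation₁₂ X, frameArea (basicSwap X)] :
      Fin 7 → MvPolynomial (Fin 7) K) i ∈ weightedHomogeneousSubmodule K basicDegree d := by
  fin_cases i
  · exact exists_degree_X 0
  · exact exists_degree_X 1
  · exact exists_degree_X 5
  · exact exists_degree_X 4
  · exact ⟨8, by norm_num, relation₈_isWeightedHomogeneous⟩
  · exact ⟨12, by norm_num, relation₁₂_isWeightedHomogeneous⟩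
  · exact ⟨8, by norm_num, frameArea_basicSwap_isWeightedHomogeneous⟩

variable [CharZero K]

variable (K) in
-- Modulo the first four variables, `relation₈` is `X 2 ^ 2`. Modulo this as well, `relation₁₂` is a
-- constant times `X 6 ^ 2`, and the last entry is a constant times `X 3 ^ 2`. So the claim reduces
-- to powers of distinct variables.
theorem regSeq_variables_relations :
    RegSeq (⊥ : Ideal (MvPolynomial (Fin 7) K)) [X 0, X 1, X 5, X 4, relation₈ X, relation₁₂ X,
      frameArea (basicSwap X)] := by
  have H := regSeq_X_pow (K := K) (![1, 1, 2, 2, 1, 1, 2] : Fin 7 → ℕ) [0, 1, 5, 4, 2, 6, 3] ∅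
    (by decide) (by simp)
  rw [Set.image_empty, Ideal.span_empty] at H
  obtain ⟨h0, h1, h5, h4, H⟩ := H
  simp only [Matrix.cons_val, pow_one] at h0 h1 h5 h4 H
  refine ⟨h0, h1, h5, h4, ?_⟩
  generalize hJ : (⊥ : Ideal (MvPolynomial (Fin 7) K)) ⊔ Ideal.span {X 0} ⊔ Ideal.span {X 1} ⊔
    Ideal.span {X 5} ⊔ Ideal.span {X 4} = J at H ⊢
  have m0 : (X 0 : MvPolynomial (Fin 7) K) ∈ J := by
    rw [← hJ]
    exact Ideal.mem_sup_left (Ideal.mem_sup_left (Ideal.mem_sup_left (Ideal.mem_sup_right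
      (Ideal.mem_span_singleton_self _))))
  have m1 : (X 1 : MvPolynomial (Fin 7) K) ∈ J := by
    rw [← hJ]
    exact Ideal.mem_sup_left (Ideal.mem_sup_left (Ideal.mem_sup_right
      (Ideal.mem_span_singleton_self _)))
  have m5 : (X 5 : MvPolynomial (Fin 7) K) ∈ J := by
    rw [← hJ]
    exact Ideal.mem_sup_left (Ideal.mem_sup_right (Ideal.mem_span_singleton_self _))
  have m4 : (X 4 : MvPolynomial (Fin 7) K) ∈ J := by
    rw [← hJ]
    exact Ideal.mem_sup_right (Ideal.mem_span_singleton_self _)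
  have hC : ∀ c : K, c ≠ 0 → (C c⁻¹ : MvPolynomial (Fin 7) K) * C c = 1 := fun c hc => by
    rw [← C_mul, inv_mul_cancel₀ hc, C_1]
  have k1 : (relation₈ X : MvPolynomial (Fin 7) K) - 1 * X 2 ^ 2 ∈ J := by
    have e : (relation₈ X : MvPolynomial (Fin 7) K) - 1 * X 2 ^ 2 =
        (-3 * X 3) * X 1 + (12 * X 4) * X 0 + (-8 * X 6 - 9 * X 5 ^ 3) * X 5 := by
      rw [relation₈]; ring
    rw [e]
    exact J.add_mem (J.add_mem (J.mul_mem_left _ m1) (J.mul_mem_left _ m0)) (J.mul_mem_left _ m5)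
  have H1 := H.head_congr (one_mul 1) k1
  refine ⟨H1.1, ?_⟩
  have H2 := H1.2
  have le1 : J ≤ J ⊔ Ideal.span {relation₈ X} := le_sup_left
  have m8 : (relation₈ X : MvPolynomial (Fin 7) K) ∈ J ⊔ Ideal.span {relation₈ X} :=
    Ideal.mem_sup_right (Ideal.mem_span_singleton_self _)
  generalize J ⊔ Ideal.span {relation₈ X} = J₁ at H2 le1 m8 ⊢
  have k2 : (relation₁₂ X : MvPolynomial (Fin 7) K) - C (-16) * X 6 ^ 2 ∈ J₁ := by
    have e : (relation₁₂ X : MvPolynomial (Fin 7) K) - C (-16) * X 6 ^ 2 =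
        (72 * X 2 * X 4 - 27 * X 3 ^ 2) * X 0 + (9 * X 2 * X 3) * X 1 + (-27 * X 1 ^ 2) * X 4
        + (-72 * X 5 ^ 2 * X 6 - 54 * X 5 ^ 5) * X 5
        + (-2 * X 2) * (relation₈ X - (relation₈ X - 1 * X 2 ^ 2)) := by
      rw [relation₁₂]
      simp only [map_neg, map_ofNat]
      ring
    rw [e]
    refine J₁.add_mem (J₁.add_mem (J₁.add_mem (J₁.add_mem ?_ ?_) ?_) ?_) ?_
    · exact J₁.mul_mem_left _ (le1 m0)
    · exact J₁.mul_mem_left _ (le1 m1)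
    · exact J₁.mul_mem_left _ (le1 m4)
    · exact J₁.mul_mem_left _ (le1 m5)
    · exact J₁.mul_mem_left _ (J₁.sub_mem m8 (le1 k1))
  have H3 := H2.head_congr (hC _ (by norm_num)) k2
  refine ⟨H3.1, ?_⟩
  have H4 := H3.2
  have le2 : J₁ ≤ J₁ ⊔ Ideal.span {relation₁₂ X} := le_sup_left
  generalize J₁ ⊔ Ideal.span {relation₁₂ X} = J₂ at H4 le2 ⊢
  have k3 : (frameArea (basicSwap X) : MvPolynomial (Fin 7) K) - C (-3) * X 3 ^ 2 ∈ J₂ := by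
    have e : (frameArea (basicSwap X) : MvPolynomial (Fin 7) K) - C (-3) * X 3 ^ 2 =
        (-12 * X 5 ^ 2 + 8 * X 2) * X 4 := by
      simp only [frameArea, basicSwap, Matrix.cons_val, map_neg, map_ofNat]
      ring
    rw [e]
    exact J₂.mul_mem_left _ (le2 (le1 m4))
  exact H4.head_congr (hC _ (by norm_num)) k3

variable (K) in
theorem regMod_X_one : RegMod ((⊥ : Ideal (MvPolynomial (Fin 7) K)) ⊔ Ideal.span {X 0} ⊔
    Ideal.span {relation₈ X} ⊔ Ideal.span {relation₁₂ X}) (X 1) := by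
  let := weightedGradedAlgebra K basicDegree
  have H := RegSeq.perm_map (weightedHomogeneousSubmodule K basicDegree) relations_degrees
    (l := [0, 1, 2, 3, 4, 5, 6]) (l' := [0, 4, 5, 1, 2, 3, 6]) (by decide)
    (regSeq_variables_relations K)
  exact H.2.2.2.1

variable (K) in
-- Modulo `X 0`, `frameArea X` is a constant times `X 1 ^ 2`. So `X 1` is moved to the end, where
-- squaring it affects no later entry, then brought back behind `X 0` and replaced.
theorem regSeq_relations_frameArea : RegSeq (⊥ : Ideal (MvPolynomial (Fin 7) K))
    [relation₈ X, relation₁₂ X, frameArea X, frameArea (basicSwap X), X 0, X 5, X 4] := by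
  let := weightedGradedAlgebra K basicDegree
  have H := RegSeq.perm_map (weightedHomogeneousSubmodule K basicDegree) relations_degrees
    (l := [0, 1, 2, 3, 4, 5, 6]) (l' := [0, 4, 5, 6, 2, 3, 1]) (by decide)
    (regSeq_variables_relations K)
  have H1 : RegSeq (⊥ : Ideal (MvPolynomial (Fin 7) K)) [X 0, relation₈ X, relation₁₂ X,
      frameArea (basicSwap X), X 5, X 4, X 1 ^ 2] := by
    obtain ⟨h0, h1, h2, h3, h4, h5, h6, -⟩ := H
    exact ⟨h0, h1, h2, h3, h4, h5, h6.pow 2, trivial⟩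
  have H2 := RegSeq.perm_map (weightedHomogeneousSubmodule K basicDegree)
    (f := ![X 0, relation₈ X, relation₁₂ X, frameArea (basicSwap X), X 5, X 4, X 1 ^ 2])
    (by
      intro i
      fin_cases i
      · exact exists_degree_X 0
      · exact ⟨8, by norm_num, relation₈_isWeightedHomogeneous⟩
      · exact ⟨12, by norm_num, relation₁₂_isWeightedHomogeneous⟩
      · exact ⟨8, by norm_num, frameArea_basicSwap_isWeightedHomogeneous⟩
      · exact exists_degree_X 5
      · exact exists_degree_X 4
      · exact ⟨_, by decide, (isWeightedHomogeneous_X K basicDegree 1).pow 2⟩)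
    (l := [0, 1, 2, 3, 4, 5, 6]) (l' := [0, 6, 1, 2, 3, 4, 5]) (by decide) H1
  have H3 : RegSeq (⊥ : Ideal (MvPolynomial (Fin 7) K)) [X 0, frameArea X, relation₈ X,
      relation₁₂ X, frameArea (basicSwap X), X 5, X 4] := by
    refine ⟨H2.1, H2.2.head_congr (u := C (-3)) (v := C (-3)⁻¹) ?_ ?_⟩
    · rw [← C_mul, inv_mul_cancel₀ (by norm_num), C_1]
    · have e : (frameArea X : MvPolynomial (Fin 7) K) - C (-3) * X 1 ^ 2 =
          (-12 * X 5 ^ 2 + 8 * X 2) * X 0 := by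
        simp only [frameArea, map_neg, map_ofNat]
        ring
      change (frameArea X : MvPolynomial (Fin 7) K) - C (-3) * X 1 ^ 2 ∈ _
      rw [e]
      exact Ideal.mul_mem_left _ _ (Ideal.mem_sup_right (Ideal.mem_span_singleton_self _))
  exact RegSeq.perm_map (weightedHomogeneousSubmodule K basicDegree)
    (f := ![X 0, frameArea X, relation₈ X, relation₁₂ X, frameArea (basicSwap X), X 5, X 4])
    (by
      intro i
      fin_cases i
      · exact exists_degree_X 0
      · exact ⟨8, by norm_num, frameArea_isWeightedHomogeneous⟩
      · exact ⟨8, by norm_num, relation₈_isWeightedHomogeneous⟩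
      · exact ⟨12, by norm_num, relation₁₂_isWeightedHomogeneous⟩
      · exact ⟨8, by norm_num, frameArea_basicSwap_isWeightedHomogeneous⟩
      · exact exists_degree_X 5
      · exact exists_degree_X 4)
    (l := [0, 1, 2, 3, 4, 5, 6]) (l' := [2, 3, 1, 4, 0, 5, 6]) (by decide) H3

theorem relation₈_mul_eq_zero (p : MvPolynomial (Fin 7) K) (h : relation₈ X * p = 0) : p = 0 :=
  (regSeq_relations_frameArea K).1 p h

variable (K) in
theorem regMod_relation₁₂ :
    RegMod (Ideal.span {(relation₈ X : MvPolynomial (Fin 7) K)}) (relation₁₂ X) := by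
  have := (regSeq_relations_frameArea K).2.1
  rwa [bot_sup_eq] at this

variable (K) in
theorem regMod_frameArea_basicSwap : RegMod (Ideal.span {(relation₈ X : MvPolynomial (Fin 7) K),
    relation₁₂ X} ⊔ Ideal.span {frameArea X}) (frameArea (basicSwap X)) := by
  have := (regSeq_relations_frameArea K).2.2.2.1
  rwa [bot_sup_eq, ← Ideal.span_union, Set.singleton_union] at this

end RegularSequences

end BinaryInvariants

namespace BinaryInvariants

open MvPolynomial

/-! ### The ideal of relations, and generation by the basic invariants. -/

section Kernel

variable {K : Type*} [Field K] [CharZero K]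

theorem eval_aeval_basic (z : Fin 2 × Fin (3 + 1) → K) (p : MvPolynomial (Fin 7) K) :
    eval z (aeval (basic K) p : invariants K 2 3) = eval (basicValue z) p := by
  have h1 : ((aeval (basic K) p : invariants K 2 3) : MvPolynomial (Fin 2 × Fin (3 + 1)) K) =
      aeval (basicPolynomial K) p := by
    have := comp_aeval (R := K) (f := basic K) (φ := (invariants K 2 3).val)
    exact DFunLike.congr_fun this p
  have h2 : (aeval z : MvPolynomial (Fin 2 × Fin (3 + 1)) K →ₐ[K] K).comp
      (aeval (basicPolynomial K)) = aeval (basicValue z) := by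
    rw [comp_aeval]
    congr 1
    ext i
    exact eval_basicPolynomial z i
  rw [h1, ← coe_aeval_eq_eval, ← coe_aeval_eq_eval]
  exact DFunLike.congr_fun h2 p

theorem aeval_basic_relation₈ : aeval (basic K)
    (relation₈ X : MvPolynomial (Fin 7) K) = 0 := by
  apply Subtype.ext
  apply MvPolynomial.funext
  intro z
  rw [eval_aeval_basic, (relation_map _ _).1]
  have h : (eval (basicValue z)) ∘ (X : Fin 7 → MvPolynomial (Fin 7) K) = basicValue z := by
    ext i
    simp
  rw [h]
  exact (relation₈_basicInvariant (fun k => z (0, k)) (fun k => z (1, k))).trans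
    (map_zero _).symm

theorem aeval_basic_relation₁₂ : aeval (basic K)
    (relation₁₂ X : MvPolynomial (Fin 7) K) = 0 := by
  apply Subtype.ext
  apply MvPolynomial.funext
  intro z
  rw [eval_aeval_basic, (relation_map _ _).2.1]
  have h : (eval (basicValue z)) ∘ (X : Fin 7 → MvPolynomial (Fin 7) K) = basicValue z := by
    ext i
    simp
  rw [h]
  exact (relation₁₂_basicInvariant (fun k => z (0, k)) (fun k => z (1, k))).trans
    (map_zero _).symm

/-- The pairs of cubic forms whose first member is `x ^ 2 * y`. -/
def slicePoint (b : Fin 4 → K) (s : Fin 2 × Fin (3 + 1)) : K :=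
  (![![0, 1, 0, 0], b] : Fin 2 → Fin 4 → K) s.1 s.2

theorem basicValue_slicePoint {K : Type*} [Field K] (b : Fin 4 → K) :
    basicValue (slicePoint b) 0 = 0 ∧ basicValue (slicePoint b) 1 = -4 * b 3 ∧
    basicValue (slicePoint b) 2 = b 2 ^ 2 - 12 * b 1 * b 3 ∧
    basicValue (slicePoint b) 5 = -b 2 ∧
    basicValue (slicePoint b) 6 = b 2 ^ 3 - 27 * b 0 * b 3 ^ 2 := by
  refine ⟨?_, ?_, ?_, ?_, ?_⟩ <;>
  simp [basicValue, basicInvariant, slicePoint, cubicDisc, cubicDisc₁, cubicDisc₂, cubicPairing,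
    cubicInvariant₆, area, contraction, cubicHessian] <;> ring

/-- Modulo `X 0`, `relation₈` solves for `X 1 * X 3`, and then `relation₁₂` for `X 1 ^ 2 * X 4`.
After inverting `X 1`, only `X 1, X 2, X 5, X 6` remain. -/
theorem exists_X_one_pow_mul_sub_mem (p : MvPolynomial (Fin 7) K) :
    ∃ (N : ℕ) (q : MvPolynomial (Fin 4) K),
      X 1 ^ N * p - aeval (![X 1, X 2, X 5, X 6] : Fin 4 → MvPolynomial (Fin 7) K) q ∈
      (⊥ : Ideal (MvPolynomial (Fin 7) K)) ⊔ Ideal.span {X 0} ⊔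
        Ideal.span {relation₈ X} ⊔ Ideal.span {relation₁₂ X} := by
  have m0 : (X 0 : MvPolynomial (Fin 7) K) ∈ (⊥ : Ideal (MvPolynomial (Fin 7) K)) ⊔
      Ideal.span {X 0} ⊔ Ideal.span {relation₈ X} ⊔ Ideal.span {relation₁₂ X} :=
    Ideal.mem_sup_left (Ideal.mem_sup_left (Ideal.mem_sup_right (Ideal.mem_span_singleton_self _)))
  have m8 : (relation₈ X : MvPolynomial (Fin 7) K) ∈ (⊥ : Ideal (MvPolynomial (Fin 7) K)) ⊔
      Ideal.span {X 0} ⊔ Ideal.span {relation₈ X} ⊔ Ideal.span {relation₁₂ X} :=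
    Ideal.mem_sup_left (Ideal.mem_sup_right (Ideal.mem_span_singleton_self _))
  have m12 : (relation₁₂ X : MvPolynomial (Fin 7) K) ∈ (⊥ : Ideal (MvPolynomial (Fin 7) K)) ⊔
      Ideal.span {X 0} ⊔ Ideal.span {relation₈ X} ⊔ Ideal.span {relation₁₂ X} :=
    Ideal.mem_sup_right (Ideal.mem_span_singleton_self _)
  generalize (⊥ : Ideal (MvPolynomial (Fin 7) K)) ⊔
      Ideal.span {X 0} ⊔ Ideal.span {relation₈ X} ⊔ Ideal.span {relation₁₂ X} = J at m0 m8 m12 ⊢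
  let ι := aeval (R := K) (![X 1, X 2, X 5, X 6] : Fin 4 → MvPolynomial (Fin 7) K)
  have i0 : ι (X 0) = X 1 := by simp [ι]
  have i1 : ι (X 1) = X 2 := by simp [ι]
  have i2 : ι (X 2) = X 5 := by simp [ι]
  have i3 : ι (X 3) = X 6 := by simp [ι]
  have iC : ∀ c, ι (C c) = C c := fun c => ι.commutes c
  let q₃ : MvPolynomial (Fin 4) K := C (1 / 3) * (X 1 ^ 2 - 8 * X 2 * X 3 - 9 * X 2 ^ 4)
  have h13 : (C (1 / 3) : MvPolynomial (Fin 7) K) * 3 = 1 := by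
    rw [show (3 : MvPolynomial (Fin 7) K) = C 3 from (map_ofNat C 3).symm, ← C_mul]
    norm_num
  have hq3 : X 1 * X 3 - ι q₃ ∈ J := by
    have e : X 1 * X 3 - ι q₃ = (-C (1 / 3)) * relation₈ X + (C (1 / 3) * 12 * X 4) * X 0
        + (1 - C (1 / 3) * 3) * (X 1 * X 3) := by
      simp only [q₃, map_mul, map_sub, map_pow, map_ofNat, i1, i2, i3, iC, relation₈]
      ring
    rw [e, h13, sub_self, zero_mul, add_zero]
    exact J.add_mem (J.mul_mem_left _ m8) (J.mul_mem_left _ m0)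
  have h127 : (C (1 / 27) : MvPolynomial (Fin 7) K) * 27 = 1 := by
    rw [show (27 : MvPolynomial (Fin 7) K) = C 27 from (map_ofNat C 27).symm, ← C_mul]
    norm_num
  let q₄ : MvPolynomial (Fin 4) K := C (1 / 27) *
    (9 * X 1 * q₃ - 2 * X 1 ^ 3 - 16 * X 3 ^ 2 - 72 * X 2 ^ 3 * X 3 - 54 * X 2 ^ 6)
  have hq4 : X 1 ^ 2 * X 4 - ι q₄ ∈ J := by
    have e : X 1 ^ 2 * X 4 - ι q₄ = (-C (1 / 27)) * relation₁₂ X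
        + (C (1 / 27) * (72 * X 2 * X 4 - 27 * X 3 ^ 2)) * X 0
        + (C (1 / 27) * 9 * X 2) * (X 1 * X 3 - ι q₃)
        + (1 - C (1 / 27) * 27) * (X 1 ^ 2 * X 4) := by
      simp only [q₄, map_mul, map_sub, map_pow, map_ofNat, i1, i2, i3, iC, relation₁₂]
      ring
    rw [e, h127, sub_self, zero_mul, add_zero]
    exact J.add_mem (J.add_mem (J.mul_mem_left _ m12) (J.mul_mem_left _ m0)) (J.mul_mem_left _ hq3)
  have hX : ∀ i : Fin 7, ∃ (M : ℕ) (q : MvPolynomial (Fin 4) K), X 1 ^ M * X i - ι q ∈ J := by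
    intro i
    fin_cases i
    · exact ⟨0, 0, by simpa using m0⟩
    · exact ⟨0, X 0, by simp [i0]⟩
    · exact ⟨0, X 1, by simp [i1]⟩
    · exact ⟨1, q₃, by rw [pow_one]; exact hq3⟩
    · exact ⟨2, q₄, hq4⟩
    · exact ⟨0, X 2, by simp [i2]⟩
    · exact ⟨0, X 3, by simp [i3]⟩
  induction p using MvPolynomial.induction_on with
  | C c =>
    refine ⟨0, C c, ?_⟩
    rw [show (aeval (![X 1, X 2, X 5, X 6] : Fin 4 → MvPolynomial (Fin 7) K)) (C c) = C c from iC c]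
    simp
  | add p p' hp hp' =>
    obtain ⟨N, q, hq⟩ := hp
    obtain ⟨N', q', hq'⟩ := hp'
    refine ⟨N + N', X 0 ^ N' * q + X 0 ^ N * q', ?_⟩
    change _ - ι _ ∈ J
    rw [map_add, map_mul, map_mul, map_pow, map_pow, i0]
    have e : X 1 ^ (N + N') * (p + p') - (X 1 ^ N' * ι q + X 1 ^ N * ι q') =
        X 1 ^ N' * (X 1 ^ N * p - ι q) + X 1 ^ N * (X 1 ^ N' * p' - ι q') := by ring
    rw [e]
    exact J.add_mem (J.mul_mem_left _ hq) (J.mul_mem_left _ hq')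
  | mul_X p i hp =>
    obtain ⟨N, q, hq⟩ := hp
    obtain ⟨M, q', hq'⟩ := hX i
    refine ⟨N + M, q * q', ?_⟩
    change _ - ι _ ∈ J
    rw [map_mul]
    have e : X 1 ^ (N + M) * (p * X i) - ι q * ι q' =
        (X 1 ^ M * X i) * (X 1 ^ N * p - ι q) + ι q * (X 1 ^ M * X i - ι q') := by ring
    rw [e]
    exact J.add_mem (J.mul_mem_left _ hq) (J.mul_mem_left _ hq')

/-- A polynomial in the basic invariants that vanishes for `x ^ 2 * y` and every second form is
in the ideal generated by the discriminant and the relations. -/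
theorem mem_of_eval_slicePoint_eq_zero {p : MvPolynomial (Fin 7) K}
    (hp : ∀ b : Fin 4 → K, eval (basicValue (slicePoint b)) p = 0) :
    p ∈ (⊥ : Ideal (MvPolynomial (Fin 7) K)) ⊔ Ideal.span {X 0} ⊔
        Ideal.span {relation₈ X} ⊔ Ideal.span {relation₁₂ X} := by
  obtain ⟨N, q, hq⟩ := exists_X_one_pow_mul_sub_mem p
  have hJ : ∀ b : Fin 4 → K, ∀ r ∈ (⊥ : Ideal (MvPolynomial (Fin 7) K)) ⊔ Ideal.span {X 0} ⊔
        Ideal.span {relation₈ X} ⊔ Ideal.span {relation₁₂ X},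
      eval (basicValue (slicePoint b)) r = 0 := by
    intro b
    have hle : (⊥ : Ideal (MvPolynomial (Fin 7) K)) ⊔ Ideal.span {X 0} ⊔
        Ideal.span {relation₈ X} ⊔ Ideal.span {relation₁₂ X} ≤
        RingHom.ker (eval (basicValue (slicePoint b))) := by
      refine sup_le (sup_le (sup_le bot_le ?_) ?_) ?_ <;>
      rw [Ideal.span_singleton_le_iff_mem, RingHom.mem_ker]
      · rw [eval_X]
        exact (basicValue_slicePoint b).1
      · rw [← eval_aeval_basic, aeval_basic_relation₈]
        simp
      · rw [← eval_aeval_basic, aeval_basic_relation₁₂]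
        simp
    exact fun r hr => hle hr
  -- Here `X 0` is the variable of `q` that stands for `X 1`. The factor handles the points with
  -- first coordinate 0, where the formula for `b` below breaks down.
  have hq0 : X 0 * q = 0 := by
    apply MvPolynomial.funext
    intro y
    rw [map_mul, eval_X, map_zero]
    by_cases hy : y 0 = 0
    · rw [hy, zero_mul]
    -- The solution of the equations in `basicValue_slicePoint` for prescribed values `y` of the
    -- invariants 1, 2, 5, 6.
    · let b : Fin 4 → K := ![(-y 2 ^ 3 - y 3) / (27 * (y 0 / 4) ^ 2), -(y 2 ^ 2 - y 1) / (3 * y 0),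
        -y 2, -y 0 / 4]
      have h1 := hJ b _ hq
      obtain ⟨-, e1, e2, e5, e6⟩ := basicValue_slicePoint b
      have f1 : basicValue (slicePoint b) 1 = y 0 := by
        rw [e1]
        simp [b]
        ring
      have f2 : basicValue (slicePoint b) 2 = y 1 := by
        rw [e2]
        simp [b]
        field_simp
        ring
      have f5 : basicValue (slicePoint b) 5 = y 2 := by
        rw [e5]
        simp [b]
      have f6 : basicValue (slicePoint b) 6 = y 3 := by
        rw [e6]
        simp [b]
        field_simp
        ring
      rw [map_sub, map_mul, hp, mul_zero, zero_sub, neg_eq_zero] at h1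
      have h2 : eval (basicValue (slicePoint b))
          (aeval (![X 1, X 2, X 5, X 6] : Fin 4 → MvPolynomial (Fin 7) K) q) = eval y q := by
        rw [← coe_aeval_eq_eval, ← coe_aeval_eq_eval, RingHom.coe_coe, ← AlgHom.comp_apply,
          comp_aeval]
        have : (fun i => aeval (basicValue (slicePoint b))
            ((![X 1, X 2, X 5, X 6] : Fin 4 → MvPolynomial (Fin 7) K) i)) = y := by
          ext i
          fin_cases i <;> simp [f1, f2, f5, f6]
        rw [this]
        rfl
      rw [← h2, h1, mul_zero]
  have hq1 : q = 0 := (mul_eq_zero.1 hq0).resolve_left (X_ne_zero 0)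
  rw [hq1, map_zero, sub_zero] at hq
  exact (regMod_X_one K).pow N p hq

theorem basicPolynomial_zero_ne_zero : aeval (basic K) (X 0 : MvPolynomial (Fin 7) K) ≠ 0 := by
  intro h
  have h1 := eval_aeval_basic (fun s => (![![0, 1, 1, 0], 0] : Fin 2 → Fin 4 → K) s.1 s.2)
    (X 0 : MvPolynomial (Fin 7) K)
  rw [h, eval_X] at h1
  simp [basicValue, basicInvariant, cubicDisc] at h1

theorem aeval_frameArea_ne_zero : aeval (basic K) (frameArea X : MvPolynomial (Fin 7) K) ≠ 0 := by
  intro h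
  have h1 := eval_aeval_basic (slicePoint ![0, 0, 0, 1]) (frameArea X : MvPolynomial (Fin 7) K)
  obtain ⟨e0, e1, -⟩ := basicValue_slicePoint (![0, 0, 0, 1] : Fin 4 → K)
  rw [h, (relation_map _ _).2.2] at h1
  simp [frameArea, e0, e1] at h1

/-- The ideal of relations between the basic invariants. -/
theorem ker_aeval_basic : RingHom.ker (aeval (R := K) (basic K)) =
    Ideal.span {(relation₈ X : MvPolynomial (Fin 7) K), relation₁₂ X} := by
  classical
  let := weightedGradedAlgebra K basicDegree
  apply le_antisymm
  · refine graded_nakayama (weightedHomogeneousSubmodule K basicDegree) (a := X 0) (k := 4) ?_ ?_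
      (by norm_num) (isWeightedHomogeneous_X K basicDegree 0) ?_
    · intro d p hp
      rw [RingHom.mem_ker] at hp ⊢
      have h1 := aeval_weightedHomogeneousComponent (𝒜 := invariantsOfDegree K 2 3)
        independentGrading_invariants basic_mem (p := p) (d := d) (by
          change aeval (basic K) p = 0 at hp
          rw [hp]
          exact Submodule.zero_mem _)
      have h2 : ((DirectSum.decompose (weightedHomogeneousSubmodule K basicDegree) p) d :
          MvPolynomial (Fin 7) K) = weightedHomogeneousComponent basicDegree d p :=
        weightedDecomposition.decompose'_apply K basicDegree p d
      rw [h2]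
      exact h1.trans hp
    · refine Ideal.homogeneous_span _ _ ?_
      rintro x (rfl | rfl)
      · exact ⟨8, relation₈_isWeightedHomogeneous⟩
      · exact ⟨12, relation₁₂_isWeightedHomogeneous⟩
    · intro n hn
      rw [RingHom.mem_ker] at hn
      change aeval (basic K) n = 0 at hn
      -- Vanishing on the slice gives `n ≡ X 0 * n'` modulo the relations; `n'` is again in the
      -- kernel because the invariants form a domain and the discriminant is not zero.
      have h1 : n ∈ Ideal.span {(relation₈ X : MvPolynomial (Fin 7) K), relation₁₂ X} ⊔
          Ideal.span {X 0} := by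
        have := mem_of_eval_slicePoint_eq_zero (p := n) fun b => by
          rw [← eval_aeval_basic, hn]
          simp
        rwa [bot_sup_eq, sup_assoc, ← Ideal.span_union (s := {relation₈ X}), Set.singleton_union,
          sup_comm] at this
      obtain ⟨n', hn'⟩ := mem_sup_span_singleton'.1 h1
      refine ⟨n', ?_, hn'⟩
      have hle : Ideal.span {(relation₈ X : MvPolynomial (Fin 7) K), relation₁₂ X} ≤
          RingHom.ker (aeval (R := K) (basic K)) := by
        rw [Ideal.span_le]
        rintro x (rfl | rfl)
        · exact aeval_basic_relation₈
        · exact aeval_basic_relation₁₂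
      have h2 : aeval (basic K) (n - X 0 * n') = 0 := hle hn'
      rw [map_sub, hn, map_mul, zero_sub, neg_eq_zero] at h2
      exact (mul_eq_zero.1 h2).resolve_left basicPolynomial_zero_ne_zero
  · rw [Ideal.span_le]
    rintro x (rfl | rfl)
    · exact aeval_basic_relation₈
    · exact aeval_basic_relation₁₂

/-- The basic invariants generate the algebra of invariants. -/
theorem aeval_basic_surjective : Function.Surjective (aeval (R := K) (basic K)) := by
  have hfun : ∀ {c : Fin 7 → MvPolynomial (Fin 7) K} {c' : (Fin 7 → K) → Fin 7 → K}
      (_ : ∀ v i, eval v (c i) = c' v i) {x : invariants K 2 3} {N : ℕ}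
      {H : MvPolynomial (Fin 7) K}, (∀ z : Fin 2 × Fin (3 + 1) → K,
        frameArea (c' (basicValue z)) ^ N * eval z (x : MvPolynomial _ K) = eval (basicValue z) H) →
      aeval (basic K) (frameArea c) ^ N * x = aeval (basic K) H := by
    intro c c' hc x N H h
    apply Subtype.ext
    apply MvPolynomial.funext
    intro z
    rw [eval_aeval_basic, ← h z, MulMemClass.coe_mul, SubmonoidClass.coe_pow, map_mul, map_pow,
      eval_aeval_basic, (relation_map _ _).2.2]
    congr 3
    exact _root_.funext fun i => hc _ i
  -- One factor of `frameArea` cancels. With s, t the two denominators, s y = p and t^N y = H give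
  -- t^N p ≡ s H modulo the relations. Regularity of t modulo the relations and s yields p ≡ s p',
  -- hence y is the image of p'.
  have step : ∀ y : invariants K 2 3, 
      aeval (basic K) (frameArea X : MvPolynomial (Fin 7) K) * y ∈ (aeval (R := K) (basic K)).range →
      y ∈ (aeval (R := K) (basic K)).range := by
    rintro y ⟨p, hp⟩
    change aeval (basic K) p = _ at hp
    obtain ⟨N, H, h⟩ := exists_frameArea_swap_pow_mul_eq y.2
    have h1 := hfun (c := basicSwap X) (c' := basicSwap) (fun v i => by
      fin_cases i <;> simp [basicSwap]) h
    have h2 : frameArea (basicSwap X) ^ N * p - frameArea X * H ∈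
        RingHom.ker (aeval (R := K) (basic K)) := by
      change aeval (basic K) _ = 0
      rw [map_sub, map_mul, map_mul, map_pow, hp, ← h1]
      ring
    rw [ker_aeval_basic] at h2
    have h3 := (regMod_frameArea_basicSwap K).pow N p (mem_sup_span_singleton'.2 ⟨H, h2⟩)
    obtain ⟨p', hp'⟩ := mem_sup_span_singleton'.1 h3
    rw [← ker_aeval_basic] at hp'
    have h4 : aeval (basic K) (p - frameArea X * p') = 0 := hp'
    rw [map_sub, map_mul, hp, ← mul_sub] at h4
    exact ⟨p', (sub_eq_zero.1 ((mul_eq_zero.1 h4).resolve_left aeval_frameArea_ne_zero)).symm⟩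
  intro x
  obtain ⟨N, H, h⟩ := exists_frameArea_pow_mul_eq x.2
  have h1 := hfun (c := X) (c' := id) (fun v i => by simp) h
  have h2 : ∀ n, aeval (basic K) (frameArea X : MvPolynomial (Fin 7) K) ^ n * x ∈ (aeval (R := K) (basic K)).range →
      x ∈ (aeval (R := K) (basic K)).range := by
    intro n
    induction n with
    | zero => exact fun h => by simpa using h
    | succ n ih => exact fun h => ih (step _ (by rwa [pow_succ', mul_assoc] at h))
  exact h2 N ⟨H, h1.symm⟩

end Kernel

end BinaryInvariants

namespace BinaryInvariants

open MvPolynomial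

/-! ### Minimality of the basic invariants. -/

section Minimality

variable {K : Type*} [Field K]

theorem X_mul_X_mul_mem {σ : Type*} (i j : σ) (p : MvPolynomial σ K) :
    X i * X j * p ∈ idealOfVars σ K ^ 2 := by
  rw [pow_two]
  exact Ideal.mul_mem_right _ _ (Ideal.mul_mem_mul (Ideal.subset_span ⟨i, rfl⟩)
    (Ideal.subset_span ⟨j, rfl⟩))

theorem span_relations_le :
    Ideal.span {(relation₈ X : MvPolynomial (Fin 7) K), relation₁₂ X} ≤
      idealOfVars (Fin 7) K ^ 2 := by
  rw [Ideal.span_le]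
  rintro x (rfl | rfl)
  · have e : (relation₈ X : MvPolynomial (Fin 7) K) = X 2 * X 2 * 1 + X 1 * X 3 * (-3)
        + X 0 * X 4 * 12 + X 5 * X 6 * (-8) + X 5 * X 5 * (-9 * X 5 ^ 2) := by
      rw [relation₈]; ring
    rw [e]
    refine Ideal.add_mem _ (Ideal.add_mem _ (Ideal.add_mem _ (Ideal.add_mem _ ?_ ?_) ?_) ?_) ?_ <;>
    exact X_mul_X_mul_mem _ _ _
  · have e : (relation₁₂ X : MvPolynomial (Fin 7) K) = X 0 * X 2 * (72 * X 4)
        + X 1 * X 2 * (9 * X 3) + X 3 * X 3 * (-27 * X 0) + X 1 * X 1 * (-27 * X 4)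
        + X 2 * X 2 * (-2 * X 2) + X 6 * X 6 * (-16)
        + X 5 * X 6 * (-72 * X 5 ^ 2) + X 5 * X 5 * (-54 * X 5 ^ 4) := by
      rw [relation₁₂]; ring
    rw [e]
    refine Ideal.add_mem _ (Ideal.add_mem _ (Ideal.add_mem _ (Ideal.add_mem _ (Ideal.add_mem _
      (Ideal.add_mem _ (Ideal.add_mem _ ?_ ?_) ?_) ?_) ?_) ?_) ?_) ?_ <;>
    exact X_mul_X_mul_mem _ _ _

variable (K) in
theorem basic_isMinimalGenerators [CharZero K] :
    IsMinimalGenerators (invariantsOfDegree K 2 3) (basic K) basicDegree where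
  homogeneous := basic_mem
  generates := by
    rw [Algebra.adjoin_range_eq_range_aeval, AlgHom.range_eq_top]
    exact aeval_basic_surjective
  irredundant := by
    -- Expressing `basic K i` by a polynomial `p` in the others would make `X i - p` a relation with
    -- linear term `X i`, but relations lie in the square of the ideal of the variables.
    intro i hi
    have h1 : (supported K {j : Fin 7 | j ≠ i}).map (aeval (basic K)) =
        Algebra.adjoin K (basic K '' {j | j ≠ i}) := by
      rw [supported_eq_adjoin_X, AlgHom.map_adjoin, Set.image_image]
      simp
    rw [← h1] at hi
    obtain ⟨p, hp, hpi⟩ := hi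
    change aeval (basic K) p = _ at hpi
    have h2 : X i - p ∈ RingHom.ker (aeval (R := K) (basic K)) := by
      change aeval (basic K) (X i - p) = 0
      rw [map_sub, aeval_X, hpi, sub_self]
    rw [ker_aeval_basic] at h2
    have h3 := (mem_pow_idealOfVars_iff' 2 _).1 (span_relations_le h2) (Finsupp.single i 1)
      (by simp)
    have h4 : coeff (Finsupp.single i 1) p = 0 := by
      by_contra hc
      have : i ∈ p.vars := (mem_vars_iff_mem_support i).2 ⟨_, mem_support_iff.2 hc, by simp⟩
      exact (mem_supported.1 hp this) rfl
    rw [coeff_sub, h4, coeff_X] at h3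
    simp at h3

end Minimality

/-! ### Transport to arbitrary minimal generators, and the theorem. -/

section Transport

theorem RegMod.map {A B : Type*} [CommRing A] [CommRing B] (e : A ≃+* B) {a b : A}
    (h : RegMod (Ideal.span {a}) b) : RegMod (Ideal.span {e a}) (e b) := by
  intro p hp
  obtain ⟨q, hq⟩ := Ideal.mem_span_singleton'.1 hp
  obtain ⟨r, hr⟩ := Ideal.mem_span_singleton'.1 (h (e.symm p)
    (Ideal.mem_span_singleton'.2 ⟨e.symm q, e.injective (by simpa using hq)⟩))
  exact Ideal.mem_span_singleton'.2 ⟨e r, by rw [← map_mul, hr, e.apply_symm_apply]⟩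

theorem isRegular_pair {A : Type*} [CommRing A] {a b : A} (h₁ : ∀ p, a * p = 0 → p = 0)
    (h₂ : RegMod (Ideal.span {a}) b) (hne : Ideal.span {a, b} ≠ ⊤) :
    RingTheory.Sequence.IsRegular A [a, b] := by
  have e2 : Ideal.ofList [a, b] = Ideal.span {a, b} := by
    rw [Ideal.ofList_cons, Ideal.ofList_singleton, ← Ideal.span_union, Set.singleton_union]
  refine ⟨⟨fun i hi => ?_⟩, ?_⟩
  · rw [isSMulRegular_quotient_iff_mem_of_smul_mem]
    intro x hx
    rw [smul_eq_mul, Ideal.mul_top] at hx ⊢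
    have hi2 : i = 0 ∨ i = 1 := by simp at hi; omega
    rcases hi2 with rfl | rfl
    · simp only [List.take_zero, Ideal.ofList_nil] at hx ⊢
      exact h₁ x hx
    · simp only [List.take_succ_cons, List.take_zero, Ideal.ofList_singleton] at hx ⊢
      exact h₂ x hx
  · rw [smul_eq_mul, Ideal.mul_top, e2]
    exact hne.symm

theorem constantCoeff_eq_zero_of_isWeightedHomogeneous {σ K : Type*} [Field K] {w : σ → ℕ}
    {p : MvPolynomial σ K} {d : ℕ} (hp : p.IsWeightedHomogeneous w d) (hd : d ≠ 0) :
    constantCoeff p = 0 := by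
  by_contra h
  have := hp (d := 0) h
  rw [map_zero] at this
  exact hd this.symm

end Transport

end BinaryInvariants

open BinaryInvariants in
theorem invariants_pair_of_cubics_of_isMinimalGenerators {K : Type*} [Field K] [CharZero K] {m : ℕ}
    {f : Fin m → invariants K 2 3} {w : Fin m → ℕ}
    (hf : IsMinimalGenerators (invariantsOfDegree K 2 3) f w) :
    ∃ r₁ r₂ : MvPolynomial (Fin m) K,
      r₁.IsWeightedHomogeneous w 8 ∧ r₂.IsWeightedHomogeneous w 12 ∧
      (∀ p, r₁ * p = 0 → p = 0) ∧ RegMod (Ideal.span {r₁}) r₂ ∧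
      RingHom.ker (MvPolynomial.aeval (R := K) f) = Ideal.span {r₁, r₂} := by
  obtain ⟨β, hβ, hβf⟩ := hf.exists_bijective_lift independentGrading_invariants
    exists_eq_algebraMap_of_mem_zero (basic_isMinimalGenerators K)
  refine ⟨β (relation₈ MvPolynomial.X), β (relation₁₂ MvPolynomial.X),
    hβ _ _ relation₈_isWeightedHomogeneous, hβ _ _ relation₁₂_isWeightedHomogeneous, ?_,
    (regMod_relation₁₂ K).map β.toRingEquiv, ?_⟩
  · intro p hp
    have := relation₈_mul_eq_zero (β.symm p) (β.injective (by
      rw [map_mul, β.apply_symm_apply, hp, map_zero]))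
    simpa using this
  · ext p
    have h1 : p ∈ RingHom.ker (MvPolynomial.aeval (R := K) f) ↔
        β.symm p ∈ RingHom.ker (MvPolynomial.aeval (R := K) (basic K)) := by
      change MvPolynomial.aeval f p = 0 ↔ MvPolynomial.aeval (basic K) (β.symm p) = 0
      rw [← hβf, β.apply_symm_apply]
    rw [h1, ker_aeval_basic, Ideal.mem_span_pair, Ideal.mem_span_pair]
    constructor
    · rintro ⟨a, b, hab⟩
      exact ⟨β a, β b, by rw [← map_mul, ← map_mul, ← map_add, hab, β.apply_symm_apply]⟩
    · rintro ⟨a, b, hab⟩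
      exact ⟨β.symm a, β.symm b, β.injective (by
        rw [map_add, map_mul, map_mul, β.apply_symm_apply, β.apply_symm_apply, hab,
          β.apply_symm_apply])⟩

theorem mainTheorem8 (K : Type*) [Field K] [CharZero K] :
    (∃ (m : ℕ) (f : Fin m → BinaryInvariants.invariants K 2 3) (w : Fin m → ℕ),
      BinaryInvariants.IsMinimalGenerators (BinaryInvariants.invariantsOfDegree K 2 3) f w) ∧
    ∀ (m : ℕ) (f : Fin m → BinaryInvariants.invariants K 2 3) (w : Fin m → ℕ),
      BinaryInvariants.IsMinimalGenerators (BinaryInvariants.invariantsOfDegree K 2 3) f w →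
      Function.Surjective (MvPolynomial.aeval (R := K) f) ∧
      (∃ r₁ r₂ : MvPolynomial (Fin m) K,
        r₁.IsWeightedHomogeneous w 8 ∧ r₂.IsWeightedHomogeneous w 12 ∧
        RingTheory.Sequence.IsRegular (MvPolynomial (Fin m) K) [r₁, r₂] ∧
        RingHom.ker (MvPolynomial.aeval (R := K) f) = Ideal.span {r₁, r₂}) ∧
      BinaryInvariants.HasMinimalFreeResolution (BinaryInvariants.invariantsOfDegree K 2 3) w
        (MvPolynomial.aeval f) [[0], [8, 12], [20]] ∧
      BinaryInvariants.homologicalDimension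
        (MvPolynomial.aeval (R := K) f : MvPolynomial (Fin m) K →ₐ[K] _).toRingHom = 2 := by
  refine ⟨⟨7, BinaryInvariants.basic K, BinaryInvariants.basicDegree,
    BinaryInvariants.basic_isMinimalGenerators K⟩, fun m f w hf => ?_⟩
  obtain ⟨r₁, r₂, h8, h12, h₁, h₂, hker⟩ :=
    invariants_pair_of_cubics_of_isMinimalGenerators hf
  have hne : Ideal.span {r₁, r₂} ≠ ⊤ := by
    rw [← hker]
    exact RingHom.ker_ne_top _
  refine ⟨hf.surjective, ⟨r₁, r₂, h8, h12, BinaryInvariants.isRegular_pair h₁ h₂ hne, hker⟩, ?_, ?_⟩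
  · exact BinaryInvariants.hasMinimalFreeResolution_of_regular _ hf.surjective
      (fun e p hp => BinaryInvariants.aeval_mem_graded hf.homogeneous hp) h8 h12
      (BinaryInvariants.constantCoeff_eq_zero_of_isWeightedHomogeneous h8 (by norm_num))
      (BinaryInvariants.constantCoeff_eq_zero_of_isWeightedHomogeneous h12 (by norm_num))
      h₁ h₂ hker
  · exact BinaryInvariants.homologicalDimension_eq_two _ hf.surjective h₁ h₂ hker hne
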